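/- Let $L$ be a finite set of field labels (all integrals $\int dx$ over labels are sums over $L$), let $V$ be the complex vector space with basis $\phi(x)$, $x\in L$, let $S(V)$ be the free commutative unital algebra on $V$, with the coproduct $\Delta$ that is the algebra homomorphism with $\Delta\phi(x)=\phi(x)\otimes 1+1\otimes\phi(x)$, and let $G_F$ be a symmetric invertible matrix indexed by $L$ (the Feynman propagator). In $S(V)^{\otimes v}$ put $R_{i,j}=\sum_{x,y}G_F^{-1}(x,y)\,\phi(x)_i\,\phi(y)_j$, where the subscripts denote the tensor factors into which the field operators are inserted. Let $Q_i=\tfrac12 R_{i,i+1}\circ\Delta_i$, where $\Delta_i$ is the coproduct applied to the $i$-th tensor factor, and define $\Omega^{0,v}:S(V)\to S(V)^{\otimes v}$ by $\Omega^{0,1}=\mathrm{id}$ and $\Omega^{0,v}=\frac1{v-1}\sum_{i=1}^{v-1}Q_i\circ\Omega^{0,v-1}$ for $v\ge2$. Let $\nu:S(V)\to\mathbb C$ be any linear map (the vertex functions). The value of a Feynman graph with $v\ge 1$ vertices, internal edges $R_{i,j}$ (self-loops and multiple edges are allowed) and external edges labelled $x_1,\dots,x_n$ is obtained by applying $\nu^{\otimes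 v}$ to the product in $S(V)^{\otimes v}$ of its internal edges $R_{i,j}$ and its external field operators $\phi(x_k)$, each placed in the factor of the vertex it is attached to. Let $\sigma^0$ be the linear map that is non-zero only on products of two fields, with $\sigma^0(\phi(x)\phi(y))=G_F(x,y)$. The connected functions $\sigma$ and the 1PI functions $\tau$ are the linear maps $S(V)\to\mathbb C[[\hbar,g]]$ with $\sigma(1)=\tau(1)=0$ and, for $n\ge1$: $\tau(\phi(x_1)\cdots\phi(x_n))$ is the sum over all one-particle irreducible Feynman graphs (connected, and still connected when any one internal edge is cut) with $v\ge1$ vertices and external edges labelled $x_1,\dots,x_n$, and $\sigma(\phi(x_1)\cdots\phi(x_n))$ is $\sigma^0(\phi(x_1)\cdots\phi(x_n))$, which represents the only graph without vertices, plus the sum over all connected such graphs. In both sums a graph with $l$ loops and $v$ vertices contributes $\hbar^l g^v$ times its value times the inverse of its symmetry factor. (a) On all elements of $S(V)$ without constant term, $$\sigma=\sigma^0+\sum_{v=1}^\infty\sigma^v,\qquad \sigma^v:=\tau^{\otimes v}\circ\Omega^{0,v},$$ where the series converges coefficientwise in $\mathbb C[[\hbar,g]]$. (b) If all 1PI one-point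 functions vanish, $\tau(\phi(x))=0$ for all $x\in L$, then this formula holds on all of $S(V)$. Moreover, for all $v\ge1$, $n\ge0$ and $x_1,\dots,x_n\in L$, $\sigma^v(\phi(x_1)\cdots\phi(x_n))$ is then the sum, each with weight $1$, over all tree graphs (up to renumbering of the vertices) with $v$ vertices and $n$ external edges labelled $x_1,\dots,x_n$ in which every vertex has valence at least two. Here the value of a tree graph is formed with the 1PI functions $\tau$ in place of $\nu$ as its vertices. -/

import Mathlib

open scoped TensorProduct MvPowerSeries.WithPiTopology

noncomputable section

namespace FieldAlgebra

/-- The field operator algebra `S(V)`: the free unital commutative `ℂ`-algebra generated by the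
elementary field operators `φ(x) = MvPolynomial.X x`, where `x` runs over the labels `L`. -/
abbrev S (L : Type*) : Type _ := MvPolynomial L ℂ

/-- The `v`-fold tensor power `S(V)^{⊗v}`, as a commutative algebra. -/
abbrev SPow (L : Type*) (v : ℕ) : Type _ := ⨂[ℂ] _ : Fin v, S L

/-- Formal power series in two variables over `ℂ`: variable `0` counts loops and variable `1`
counts vertices. -/
abbrev Series : Type := MvPowerSeries (Fin 2) ℂ

/-- `a ↦ 1 ⊗ ⋯ ⊗ a ⊗ ⋯ ⊗ 1`, with `a` in the factor `i`. -/
def slot {L : Type*} {v : ℕ} (i : Fin v) : S L →ₐ[ℂ] SPow L v :=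
  PiTensorProduct.singleAlgHom (R := ℂ) (A := fun _ : Fin v => S L) i

/-- The coproduct of `S(V)`: the algebra homomorphism with `φ(x) ↦ φ(x) ⊗ 1 + 1 ⊗ φ(x)`. -/
def cop (L : Type*) : S L →ₐ[ℂ] (S L ⊗[ℂ] S L) :=
  MvPolynomial.aeval fun x => MvPolynomial.X x ⊗ₜ[ℂ] 1 + 1 ⊗ₜ[ℂ] MvPolynomial.X x

/-- The coproduct applied to the factor `i` of `S(V)^{⊗(v+1)}`. The factors before `i` keep
their positions, the factors after `i` move up by one, and the two halves of the factor `i` land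
in the positions `i` and `i + 1`. -/
def copAt {L : Type*} {v : ℕ} (i : Fin (v + 1)) : SPow L (v + 1) →ₗ[ℂ] SPow L (v + 2) :=
  PiTensorProduct.lift
    ((MultilinearMap.mkPiAlgebra ℂ (Fin (v + 1)) (SPow L (v + 2))).compLinearMap fun j =>
      if j < i then (slot j.castSucc).toLinearMap
      else if j = i then
        ((Algebra.TensorProduct.lift (slot i.castSucc) (slot i.succ)
          (fun _ _ => Commute.all _ _)).comp (cop L)).toLinearMap
      else (slot j.succ).toLinearMap)

/-- `f^{⊗v} : S(V)^{⊗v} → B`, i.e. `a₁ ⊗ ⋯ ⊗ a_v ↦ f(a₁) ⋯ f(a_v)`. -/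
def tensorEval {L : Type*} {B : Type*} [CommRing B] [Algebra ℂ B] (f : S L →ₗ[ℂ] B) (v : ℕ) :
    SPow L v →ₗ[ℂ] B :=
  PiTensorProduct.lift
    ((MultilinearMap.mkPiAlgebra ℂ (Fin v) B).compLinearMap fun _ => f)

/-- The iterated coproduct `S(V) → S(V)^{⊗v}`, `φ(x) ↦ ∑ᵢ 1 ⊗ ⋯ ⊗ φ(x) ⊗ ⋯ ⊗ 1`. It attaches the
external edges to `v` numbered vertices in all possible ways, see `legs_prod`. -/
def legs (L : Type*) (v : ℕ) : S L →ₐ[ℂ] SPow L v :=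
  MvPolynomial.aeval fun x => ∑ i, slot i (MvPolynomial.X x)

theorem legs_prod {L : Type*} (v n : ℕ) (x : Fin n → L) :
    legs L v (∏ k, MvPolynomial.X (x k)) =
      ∑ f : Fin n → Fin v, ∏ k, slot (f k) (MvPolynomial.X (x k)) := by
  rw [map_prod]
  simp only [legs, MvPolynomial.aeval_X]
  exact Finset.prod_univ_sum (fun _ => Finset.univ) _

section Propagator

/-- The internal edge `R_{i,j}` joining the vertices `i` and `j` (a self-loop if `i = j`):
`∑_{x,y} G_F⁻¹(x,y) φ(x)_i φ(y)_j`. -/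
def R {L : Type*} [Fintype L] [DecidableEq L] (G : Matrix L L ℂ) {v : ℕ} (i j : Fin v) :
    SPow L v :=
  ∑ x, ∑ y, (G⁻¹ x y) • (slot i (MvPolynomial.X x) * slot j (MvPolynomial.X y))

/-- `Q_i = ½ R_{i,i+1} ∘ Δ_i`. -/
def Q {L : Type*} [Fintype L] [DecidableEq L] (G : Matrix L L ℂ) {v : ℕ} (i : Fin (v + 1)) :
    SPow L (v + 1) →ₗ[ℂ] SPow L (v + 2) :=
  (1 / 2 : ℂ) • (PiTensorProduct.mul (R G i.castSucc i.succ) ∘ₗ copAt i)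

/-- `OmegaTree G v` is `Ω^{0,v+1} : S(V) → S(V)^{⊗(v+1)}`: `Ω^{0,1} = id` and
`Ω^{0,v} = (v-1)⁻¹ ∑_{i=1}^{v-1} Q_i ∘ Ω^{0,v-1}` for `v ≥ 2`. -/
def OmegaTree {L : Type*} [Fintype L] [DecidableEq L] (G : Matrix L L ℂ) :
    (v : ℕ) → S L →ₗ[ℂ] SPow L (v + 1)
  | 0 => (slot 0).toLinearMap
  | v + 1 => (1 / ((v : ℂ) + 1)) • ∑ i : Fin (v + 1), Q G i ∘ₗ OmegaTree G v

/-- The propagator term `σ⁰`: it is `G_F(x,y)` on `φ(x)φ(y)` and zero on products of any other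
number of field operators (`G_F` being symmetric). -/
def sigmaZero {L : Type*} [Fintype L] (G : Matrix L L ℂ) : S L →ₗ[ℂ] ℂ :=
  (1 / 2 : ℂ) • ∑ x, ∑ y, G x y •
    ((MvPolynomial.aeval (R := ℂ) (fun _ : L => (0 : ℂ))).toLinearMap ∘ₗ
      (MvPolynomial.pderiv x).toLinearMap ∘ₗ (MvPolynomial.pderiv y).toLinearMap)

end Propagator

/-- The simple graph underlying a multigraph with vertex set `Fin v` and edges `Fin e`, edge `k`
having the end points `(s k).1` and `(s k).2`, where only the edges satisfying `p` are kept. -/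
def skeleton {v e : ℕ} (s : Fin e → Fin v × Fin v) (p : Fin e → Prop) : SimpleGraph (Fin v) :=
  SimpleGraph.fromRel fun i j => ∃ k, p k ∧ s k = (i, j)

/-- The multigraph is connected (and has at least one vertex). -/
def IsConn {v e : ℕ} (s : Fin e → Fin v × Fin v) : Prop :=
  (skeleton s fun _ => True).Connected

/-- The multigraph is one-particle irreducible: it is connected, and remains connected when any
one of its internal edges is cut. -/
def IsOnePI {v e : ℕ} (s : Fin e → Fin v × Fin v) : Prop :=
  IsConn s ∧ ∀ k, (skeleton s fun k' => k' ≠ k).Connected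

/-- The sum of all Feynman graphs of the class `P` with `v` vertices, `e` internal edges and at
least one external edge, each weighted by the inverse of its symmetry factor, with vertex
functions `ν` and internal edges contracted with `G_F⁻¹`. The sum runs over graphs whose vertices
are numbered and whose internal edges are numbered and oriented. A graph whose automorphism group
(fixing the external edges) has order `s` occurs exactly `v! e! 2^e / s` times, so after the
division by `v! e! 2^e` it has weight `1 / s`. Functions without external edges are zero by
convention, so the constant term of the argument is discarded. -/
def graphSum {L : Type*} [Fintype L] [DecidableEq L] (G : Matrix L L ℂ) (ν : S L →ₗ[ℂ] ℂ)
    (P : {v e : ℕ} → (Fin e → Fin v × Fin v) → Prop) (v e : ℕ) : S L →ₗ[ℂ] ℂ :=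
  open scoped Classical in
  (1 / ((v.factorial : ℂ) * (e.factorial : ℂ) * 2 ^ e)) •
    ∑ s : Fin e → Fin v × Fin v, if P s then
      tensorEval ν v ∘ₗ PiTensorProduct.mul (∏ k, R G (s k).1 (s k).2) ∘ₗ
        (legs L v).toLinearMap ∘ₗ
          (LinearMap.id - Algebra.linearMap ℂ (S L) ∘ₗ
            (MvPolynomial.aeval (R := ℂ) (fun _ : L => (0 : ℂ))).toLinearMap)
    else 0

/-- The formal series whose coefficient at `l` loops and `v` vertices is `F l v`. -/
def formalSum {L : Type*} (F : ℕ → ℕ → S L →ₗ[ℂ] ℂ) : S L →ₗ[ℂ] Series where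
  toFun a := fun d => F (d 0) (d 1) a
  map_add' a b := by funext d; exact map_add (F (d 0) (d 1)) a b
  map_smul' c a := by funext d; exact map_smul (F (d 0) (d 1)) c a

/-- `σ⁰` as a series: no loops and no vertices. -/
def propagator {L : Type*} [Fintype L] (G : Matrix L L ℂ) : S L →ₗ[ℂ] Series :=
  (Algebra.linearMap ℂ Series) ∘ₗ sigmaZero G

/-- The 1PI functions `τ`: the sum over all 1PI Feynman graphs. A connected graph with `l` loops
and `v` vertices has `l + v - 1` internal edges; no graph with `v = 0` is 1PI. -/
def onePI {L : Type*} [Fintype L] [DecidableEq L] (G : Matrix L L ℂ) (ν : S L →ₗ[ℂ] ℂ) :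
    S L →ₗ[ℂ] Series :=
  formalSum fun l v => graphSum G ν IsOnePI v (l + v - 1)

/-- The connected functions `σ`: the sum over all connected Feynman graphs with at least one
vertex, plus the only graph without vertices, the Feynman propagator. -/
def connected {L : Type*} [Fintype L] [DecidableEq L] (G : Matrix L L ℂ) (ν : S L →ₗ[ℂ] ℂ) :
    S L →ₗ[ℂ] Series :=
  propagator G + formalSum fun l v => graphSum G ν IsConn v (l + v - 1)

/-- `σ^{v+1} = τ^{⊗(v+1)} ∘ Ω^{0,v+1}`. -/
def sigmaTerm {L : Type*} [Fintype L] [DecidableEq L] (G : Matrix L L ℂ) (τ : S L →ₗ[ℂ] Series)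
    (v : ℕ) : S L →ₗ[ℂ] Series :=
  tensorEval τ (v + 1) ∘ₗ OmegaTree G v

/-- Vertex-numbered tree graphs with `v` vertices and `n` external edges labelled by `Fin n`, in
which every vertex has valence at least two (counting internal and external edges). -/
structure TreeGraph (v n : ℕ) where
  graph : SimpleGraph (Fin v)
  leg : Fin n → Fin v
  isTree : graph.IsTree
  two_le_valence : ∀ i, 2 ≤ (graph.neighborSet i).ncard + {k | leg k = i}.ncard

/-- Two vertex-numbered tree graphs are equivalent if they differ by a renumbering of the
vertices. -/
def treeSetoid (v n : ℕ) : Setoid (TreeGraph v n) where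
  r s t := ∃ π : Equiv.Perm (Fin v),
    (∀ i j, t.graph.Adj (π i) (π j) ↔ s.graph.Adj i j) ∧ ∀ k, t.leg k = π (s.leg k)
  iseqv :=
    { refl := fun s => ⟨1, fun _ _ => Iff.rfl, fun _ => rfl⟩
      symm := by
        rintro s t ⟨π, h, h'⟩
        refine ⟨π⁻¹, fun i j => ?_, fun k => ?_⟩
        · rw [← h]; simp
        · simp [h']
      trans := by
        rintro s t u ⟨π, h, h'⟩ ⟨ρ, g, g'⟩
        refine ⟨ρ * π, fun i j => ?_, fun k => ?_⟩
        · simp only [Equiv.Perm.mul_apply]; rw [g, h]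
        · simp [g', h'] }

/-- Tree graphs with unnumbered vertices. -/
def UnorderedTree (v n : ℕ) : Type := Quotient (treeSetoid v n)

/-- The value of a tree graph with external labels `x` and vertex functions `τ`. -/
def treeValue {L : Type*} [Fintype L] [DecidableEq L] (G : Matrix L L ℂ) (τ : S L →ₗ[ℂ] Series)
    {v n : ℕ} (x : Fin n → L) (t : TreeGraph v n) : Series :=
  open scoped Classical in
  tensorEval τ v
    ((∏ p ∈ Finset.univ.filter fun p : Fin v × Fin v => p.1 < p.2 ∧ t.graph.Adj p.1 p.2,
        R G p.1 p.2) *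
      ∏ k, slot (t.leg k) (MvPolynomial.X (x k)))

end FieldAlgebra

end

/-!
Both sides of the expansion satisfy the same quadratic recursion, obtained by cutting one edge.
For linear maps `f`, `g` on `S(V)`, let `join G f g a = (f ⊗ g)(R_{1,2} Δ a)`: the operation that
links a graph counted by `f` to a graph counted by `g` by an internal edge and distributes the
external edges over the two.

*Graphs.* Let `connGraphs v e b` be the sum of all connected graphs with `v` vertices, `e` edges
and exactly `b` bridges. If one of the bridges of such a graph is marked and removed, two connected
graphs remain, which have `b - 1` bridges in total; conversely, linking two connected graphs by a
new edge makes that edge a bridge and creates no other one (`markedSum_eq`). Since a graph with `b`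
bridges can be marked in `b` ways, and the choices of the vertex and edge numbers of the two parts
account for the binomial coefficients in the symmetry factors, this gives
`b C_b = ½ ∑_{i + j = b - 1} join C_i C_j` (`connGraphs_succ`, and `bridgeSeries_succ` for the
formal series). Here `C_0` is the 1PI function `τ` up to constant terms, which `join` does not see,
and `∑_b C_b` is the sum of all connected graphs.

*Trees.* The maps `σ_b = τ^{⊗(b+1)} ∘ Ω^{0,b+1}` satisfy `b σ_b = ½ ∑_{i + j = b - 1} join σ_i σ_j`
(`treeSum_succ`). The reason is that the transpose of `Q_i` replaces the two factors `τ` at `i` and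
`i + 1` by `½ join τ τ` at `i`, so that `2 b σ_b` is the derivative of `τ ↦ σ_{b-1}` in the
direction `join τ τ`. The recursion for `σ_{b+1}` is then the `ε`-coefficient of the recursion for
`σ_b`, applied to the vertex function `τ + ε (join τ τ)` over the dual numbers.

Hence `C_b = σ_b` off the constants (`treeSum_onePI`), which is the expansion. If the one-point
functions vanish, the recursion shows that all `σ_b` vanish on constants.

*Tree graphs.* The recursion for graphs holds for vertex functions with values in any algebra. With
`τ` itself as the vertex function, the graphs with as many bridges as edges satisfy the recursion
of `σ_b`, so that `σ_b` is the sum over all trees with numbered vertices, divided by `(b + 1)!`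
(`treeSum_eq_sum_isTree`). A tree with a vertex of valence less than two contributes a factor
`τ(1)` or `τ(φ(x))`, hence nothing. The other trees have no automorphisms, because every vertex
with at most one neighbour carries an external edge, and an automorphism of a tree that fixes
these vertices is the identity (`tree_perm_eq_one`). So each of them has exactly `(b + 1)!`
numberings, and its weight is `1`.
-/

noncomputable section

namespace FieldAlgebra

/-! ### Tensor powers over arbitrary vertex types -/

section TensorPowers

variable {L : Type*} {B : Type*} [CommRing B] [Algebra ℂ B] {V W V₁ V₂ : Type}

/-- The tensor power of `S(V)` with factors indexed by an arbitrary type of vertices. -/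
abbrev VPow (L : Type*) (V : Type) : Type _ := ⨂[ℂ] _ : V, S L

/-- The embedding of `S(V)` as the tensor factor of the vertex `i`. -/
def put [DecidableEq V] (i : V) : S L →ₐ[ℂ] VPow L V :=
  PiTensorProduct.singleAlgHom (R := ℂ) (A := fun _ : V => S L) i

/-- `f^{⊗V}` for a linear map `f`, the version of `tensorEval` for arbitrary vertex types. -/
def evalV [Fintype V] (f : S L →ₗ[ℂ] B) : VPow L V →ₗ[ℂ] B :=
  PiTensorProduct.lift ((MultilinearMap.mkPiAlgebra ℂ V B).compLinearMap fun _ => f)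

/-- The iterated coproduct with values in an arbitrary tensor power. -/
def legsV (L : Type*) (V : Type) [Fintype V] [DecidableEq V] : S L →ₐ[ℂ] VPow L V :=
  MvPolynomial.aeval fun x => ∑ i : V, put i (MvPolynomial.X x)

/-- The map `f ⊗ g` followed by multiplication, `a ⊗ b ↦ f(a) g(b)`. -/
def mulT (f g : S L →ₗ[ℂ] B) : S L ⊗[ℂ] S L →ₗ[ℂ] B :=
  LinearMap.mul' ℂ B ∘ₗ TensorProduct.map f g

@[simp]
theorem mulT_tmul (f g : S L →ₗ[ℂ] B) (a b : S L) : mulT f g (a ⊗ₜ b) = f a * g b := rfl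

theorem tprod_eq_prod_put [Fintype V] [DecidableEq V] (a : V → S L) :
    PiTensorProduct.tprod ℂ a = ∏ i, put i (a i) := by
  have h : a = ∏ i, MonoidHom.mulSingle (fun _ : V => S L) i (a i) :=
    (Finset.univ_prod_mulSingle a).symm
  conv_lhs => rw [h]
  exact PiTensorProduct.tprod_prod _ _

@[simp]
theorem evalV_prod_put [Fintype V] [DecidableEq V] (f : S L →ₗ[ℂ] B) (a : V → S L) :
    evalV f (∏ i, put i (a i)) = ∏ i, f (a i) := by
  rw [← tprod_eq_prod_put]; simp [evalV]

/-- Linear maps on a tensor power agree if they agree on products of embedded elements. -/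
theorem vpow_hom_ext [Fintype V] [DecidableEq V] {M : Type*} [AddCommMonoid M] [Module ℂ M]
    {f g : VPow L V →ₗ[ℂ] M}
    (h : ∀ a : V → S L, f (∏ i, put i (a i)) = g (∏ i, put i (a i))) : f = g := by
  refine PiTensorProduct.ext (MultilinearMap.ext fun a => ?_)
  simpa [tprod_eq_prod_put] using h a

/-- The algebra homomorphism between tensor powers that moves the factor `i` to the factor
`g i`. -/
def place [Fintype V] [DecidableEq W] (g : V → W) : VPow L V →ₐ[ℂ] VPow L W :=
  PiTensorProduct.liftAlgHom
    ((MultilinearMap.mkPiAlgebra ℂ V (VPow L W)).compLinearMap fun i => (put (g i)).toLinearMap)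
    (by simp) (by intro x y; simp [Finset.prod_mul_distrib])

theorem place_prod_put [Fintype V] [DecidableEq V] [DecidableEq W] (g : V → W) (a : V → S L) :
    place g (∏ i, put i (a i)) = ∏ i, put (g i) (a i) := by
  rw [← tprod_eq_prod_put]
  exact PiTensorProduct.lift.tprod _

@[simp]
theorem place_put [Fintype V] [DecidableEq V] [DecidableEq W] (g : V → W) (i : V) (a : S L) :
    place g (put i a) = put (g i) a := by
  have h := place_prod_put g (Function.update (fun _ => (1 : S L)) i a)
  rw [Finset.prod_eq_single i, Finset.prod_eq_single i] at h
  · simpa using h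
  all_goals simp +contextual [Function.update_of_ne]

theorem evalV_place_equiv [Fintype V] [Fintype W] [DecidableEq V] [DecidableEq W] (e : V ≃ W)
    (f : S L →ₗ[ℂ] B) (t : VPow L V) : evalV f (place e t) = evalV f t := by
  have : evalV f ∘ₗ (place (L := L) e).toLinearMap = evalV f := by
    refine vpow_hom_ext fun a => ?_
    simp only [LinearMap.comp_apply, AlgHom.toLinearMap_apply, place_prod_put]
    have : ∏ i, put (e i) (a i) = ∏ j, put j (a (e.symm j)) := by
      rw [← e.prod_comp]; simp
    rw [this, evalV_prod_put, evalV_prod_put, ← e.prod_comp]; simp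
  exact LinearMap.congr_fun this t

/-- `f^{⊗V}` is multiplicative over a partition of the vertices into two parts. -/
theorem evalV_place_mul_place [Fintype V] [Fintype V₁] [Fintype V₂] [DecidableEq V]
    [DecidableEq V₁] [DecidableEq V₂] (e : V₁ ⊕ V₂ ≃ V) (f : S L →ₗ[ℂ] B) (s : VPow L V₁)
    (t : VPow L V₂) :
    evalV f (place (e ∘ Sum.inl) s * place (e ∘ Sum.inr) t) = evalV f s * evalV f t := by
  have key : ((PiTensorProduct.mul (R := ℂ) (A := fun _ : V => S L)).compl₁₂ (place (L := L) (e ∘ Sum.inl)).toLinearMap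
        (place (L := L) (e ∘ Sum.inr)).toLinearMap).compr₂ (evalV f) =
      (LinearMap.mul ℂ B).compl₁₂ (evalV f) (evalV f) := by
    refine vpow_hom_ext fun a => vpow_hom_ext fun b => ?_
    simp only [LinearMap.compr₂_apply, LinearMap.compl₁₂_apply, AlgHom.toLinearMap_apply,
      place_prod_put, LinearMap.mul_apply', evalV_prod_put, Function.comp_apply,
      ← PiTensorProduct.mul_def]
    have : (∏ i, put (e (Sum.inl i)) (a i)) * ∏ i, put (e (Sum.inr i)) (b i) =
        ∏ j, put j (Sum.elim a b (e.symm j)) := by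
      rw [← e.prod_comp, Fintype.prod_sum_type]; simp
    rw [this, evalV_prod_put, ← e.prod_comp, Fintype.prod_sum_type]; simp
  exact LinearMap.congr_fun₂ key s t

/-- The iterated coproduct over a disjoint union of vertex sets is the coproduct followed by the
iterated coproducts over the two parts. -/
theorem lift_place_legsV_comp_cop [Fintype V] [Fintype V₁] [Fintype V₂] [DecidableEq V]
    [DecidableEq V₁] [DecidableEq V₂] (e : V₁ ⊕ V₂ ≃ V) :
    (Algebra.TensorProduct.lift ((place (e ∘ Sum.inl)).comp (legsV L V₁))
      ((place (e ∘ Sum.inr)).comp (legsV L V₂)) (fun _ _ => Commute.all _ _)).comp (cop L) =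
      legsV L V := by
  ext x
  simp [cop, legsV, ← e.sum_comp]

theorem place_equiv_legsV [Fintype V] [Fintype W] [DecidableEq V] [DecidableEq W] (e : V ≃ W)
    (a : S L) : place e (legsV L V a) = legsV L W a := by
  have : (place e).comp (legsV L V) = legsV L W := by
    ext x
    simp [legsV, ← e.sum_comp]
  exact AlgHom.congr_fun this a

section Edges

variable [Fintype L] [DecidableEq L] (G : Matrix L L ℂ)

/-- The internal edge `R_{i,j}` in an arbitrary tensor power. -/
def edge [DecidableEq V] (i j : V) : VPow L V :=
  ∑ x, ∑ y, (G⁻¹ x y) • (put i (MvPolynomial.X x) * put j (MvPolynomial.X y))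

/-- The internal edge between the two factors of `S(V) ⊗ S(V)`. -/
def edgeT : S L ⊗[ℂ] S L :=
  ∑ x, ∑ y, (G⁻¹ x y) • (MvPolynomial.X x ⊗ₜ[ℂ] MvPolynomial.X y)

/-- The bilinear operation `(f, g) ↦ (f ⊗ g)(R_{1,2} Δ a)`: it connects two graphs by an internal
edge, distributing the external edges in all possible ways. -/
def join (f g : S L →ₗ[ℂ] B) : S L →ₗ[ℂ] B :=
  mulT f g ∘ₗ LinearMap.mulLeft ℂ (edgeT G) ∘ₗ (cop L).toLinearMap

theorem join_apply (f g : S L →ₗ[ℂ] B) (a : S L) :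
    join G f g a = mulT f g (edgeT G * cop L a) := rfl

theorem place_edge [Fintype V] [DecidableEq V] [DecidableEq W] (g : V → W) (i j : V) :
    place g (edge G i j) = edge G (g i) (g j) := by
  simp [edge]

/-- Connecting all pairs of vertices of the two parts of a graph gives the operation `join`. -/
theorem sum_evalV_edge_mul [Fintype V] [Fintype V₁] [Fintype V₂] [DecidableEq V]
    [DecidableEq V₁] [DecidableEq V₂] (e : V₁ ⊕ V₂ ≃ V) (f : S L →ₗ[ℂ] B) (s : VPow L V₁)
    (t : VPow L V₂) (a : S L) :
    ∑ p, ∑ q, evalV f (edge G (e (Sum.inl p)) (e (Sum.inr q)) *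
        (place (e ∘ Sum.inl) s * place (e ∘ Sum.inr) t) * legsV L V a) =
      join G (evalV f ∘ₗ PiTensorProduct.mul s ∘ₗ (legsV L V₁).toLinearMap)
        (evalV f ∘ₗ PiTensorProduct.mul t ∘ₗ (legsV L V₂).toLinearMap) a := by
  set Λ := Algebra.TensorProduct.lift ((place (e ∘ Sum.inl)).comp (legsV L V₁))
      ((place (e ∘ Sum.inr)).comp (legsV L V₂)) (fun _ _ => Commute.all _ _) with hΛ
  have hedge : ∑ p, ∑ q, edge G (e (Sum.inl p)) (e (Sum.inr q)) = Λ (edgeT G) := by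
    simp only [edge, edgeT, map_sum, map_smul, hΛ, Algebra.TensorProduct.lift_tmul,
      AlgHom.comp_apply, legsV, MvPolynomial.aeval_X, place_put, Function.comp_apply,
      Finset.sum_mul_sum, Finset.smul_sum]
    simp_rw [Finset.sum_comm (s := (Finset.univ : Finset V₂)) (t := (Finset.univ : Finset L))]
    rw [Finset.sum_comm]
    refine Finset.sum_congr rfl fun x _ => ?_
    rw [Finset.sum_comm]
  have hlegs : legsV L V a = Λ (cop L a) := by
    rw [hΛ, ← lift_place_legsV_comp_cop e]; rfl
  have key : evalV f ∘ₗ PiTensorProduct.mul (place (e ∘ Sum.inl) s * place (e ∘ Sum.inr) t) ∘ₗ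
      Λ.toLinearMap = mulT (evalV f ∘ₗ PiTensorProduct.mul s ∘ₗ (legsV L V₁).toLinearMap)
        (evalV f ∘ₗ PiTensorProduct.mul t ∘ₗ (legsV L V₂).toLinearMap) := by
    refine TensorProduct.ext' fun b c => ?_
    simp only [LinearMap.comp_apply, AlgHom.toLinearMap_apply, ← PiTensorProduct.mul_def, hΛ,
      Algebra.TensorProduct.lift_tmul, AlgHom.comp_apply, mulT_tmul, mul_mul_mul_comm, ← map_mul]
    exact evalV_place_mul_place e f _ _
  rw [join_apply, ← key]
  simp only [LinearMap.comp_apply, AlgHom.toLinearMap_apply, ← PiTensorProduct.mul_def, map_mul,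
    ← hlegs, ← hedge, ← map_sum]
  congr 1
  simp only [Finset.sum_mul, Finset.mul_sum]
  refine Finset.sum_congr rfl fun p _ => Finset.sum_congr rfl fun q _ => ?_
  ring

end Edges

end TensorPowers

/-! ### Cutting a bridge of a multigraph -/

section Multigraphs

variable {V W V₁ V₂ E E' E₁ E₂ : Type}

/-- Two vertices of the multigraph with edges `s` are joined if they are connected by a path of
edges from the set `F`. -/
def Joined (s : E → V × V) (F : Set E) : V → V → Prop :=
  Relation.EqvGen fun i j => ∃ k ∈ F, s k = (i, j)

/-- The multigraph with edges `s`, restricted to the edges in `F`, is connected and non-empty. -/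
def Conn (s : E → V × V) (F : Set E) : Prop :=
  Nonempty V ∧ ∀ i j, Joined s F i j

/-- The edges whose removal leaves a disconnected graph. -/
def bridges (s : E → V × V) : Set E := {k | ¬ Conn s {k}ᶜ}

namespace Joined

variable {s : E → V × V} {F : Set E}

theorem refl (s : E → V × V) (F : Set E) (i : V) : Joined s F i i := Relation.EqvGen.refl i

theorem symm {i j : V} (h : Joined s F i j) : Joined s F j i := Relation.EqvGen.symm _ _ h

theorem trans {i j k : V} (h : Joined s F i j) (h' : Joined s F j k) : Joined s F i k :=
  Relation.EqvGen.trans _ _ _ h h'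

theorem edge {k : E} (hk : k ∈ F) : Joined s F (s k).1 (s k).2 :=
  Relation.EqvGen.rel _ _ ⟨k, hk, rfl⟩

/-- A map of vertices under which the end points of every edge stay joined preserves
joinedness. -/
theorem map {s' : E' → W × W} {F' : Set E'} (g : V → W)
    (hg : ∀ k ∈ F, Joined s' F' (g (s k).1) (g (s k).2)) {i j : V} (h : Joined s F i j) :
    Joined s' F' (g i) (g j) := by
  induction h with
  | rel i j h =>
    obtain ⟨k, hk, h⟩ := h
    simpa [h] using hg k hk
  | refl i => exact refl _ _ _
  | symm i j _ ih => exact ih.symm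
  | trans i j k _ _ ih ih' => exact ih.trans ih'

/-- A function that is constant along edges is constant along joined vertices. -/
theorem apply_eq {α : Type*} (g : V → α) (hg : ∀ k ∈ F, g (s k).1 = g (s k).2) {i j : V}
    (h : Joined s F i j) : g i = g j := by
  induction h with
  | rel i j h =>
    obtain ⟨k, hk, h⟩ := h
    simpa [h] using hg k hk
  | refl i => rfl
  | symm i j _ ih => exact ih.symm
  | trans i j k _ _ ih ih' => exact ih.trans ih'

end Joined

theorem Conn.map {s : E → V × V} {F : Set E} {s' : E' → W × W} {F' : Set E'} (h : Conn s F)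
    (g : V → W) (hsurj : Function.Surjective g)
    (hg : ∀ k ∈ F, Joined s' F' (g (s k).1) (g (s k).2)) : Conn s' F' := by
  refine ⟨h.1.map g, fun i j => ?_⟩
  obtain ⟨i, rfl⟩ := hsurj i
  obtain ⟨j, rfl⟩ := hsurj j
  exact (h.2 i j).map g hg

/-- Renaming of vertices and edges. -/
def relabel (eV : V ≃ W) (eE : E ≃ E') (s : E → V × V) : E' → W × W :=
  fun k => Prod.map eV eV (s (eE.symm k))

theorem bijective_relabel (eV : V ≃ W) (eE : E ≃ E') :
    Function.Bijective (relabel eV eE) :=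
  (Equiv.arrowCongr eE (Equiv.prodCongr eV eV)).bijective

theorem conn_relabel (eV : V ≃ W) (eE : E ≃ E') (s : E → V × V) (F : Set E') :
    Conn (relabel eV eE s) F ↔ Conn s (eE ⁻¹' F) := by
  constructor
  · intro h
    refine h.map eV.symm eV.symm.surjective fun k hk => ?_
    have := Joined.edge (s := s) (F := eE ⁻¹' F) (k := eE.symm k) (by simpa using hk)
    simpa [relabel] using this
  · intro h
    refine h.map eV eV.surjective fun k hk => ?_
    have := Joined.edge (s := relabel eV eE s) (F := F) (k := eE k) hk
    simpa [relabel] using this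

theorem bridges_relabel (eV : V ≃ W) (eE : E ≃ E') (s : E → V × V) :
    bridges (relabel eV eE s) = eE '' bridges s := by
  ext k
  obtain ⟨k, rfl⟩ := eE.surjective k
  rw [eE.injective.mem_set_image]
  simp only [bridges, Set.mem_ofPred_eq, conn_relabel]
  have : eE ⁻¹' {eE k}ᶜ = {k}ᶜ := by ext; simp
  rw [this]

theorem ncard_bridges_relabel (eV : V ≃ W) (eE : E ≃ E') (s : E → V × V) :
    (bridges (relabel eV eE s)).ncard = (bridges s).ncard := by
  rw [bridges_relabel, Set.ncard_image_of_injective _ eE.injective]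

/-- The disjoint union of two multigraphs, connected by one more edge `none`. -/
def link (p : V₁) (q : V₂) (s₁ : E₁ → V₁ × V₁) (s₂ : E₂ → V₂ × V₂) :
    Option (E₁ ⊕ E₂) → (V₁ ⊕ V₂) × (V₁ ⊕ V₂)
  | none => (Sum.inl p, Sum.inr q)
  | some (Sum.inl k) => Prod.map Sum.inl Sum.inl (s₁ k)
  | some (Sum.inr k) => Prod.map Sum.inr Sum.inr (s₂ k)

section Link

variable (p : V₁) (q : V₂) (s₁ : E₁ → V₁ × V₁) (s₂ : E₂ → V₂ × V₂)

theorem link_not_joined {F : Set (Option (E₁ ⊕ E₂))} (hF : none ∉ F) (x : V₁) (y : V₂) :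
    ¬ Joined (link p q s₁ s₂) F (Sum.inl x) (Sum.inr y) := by
  intro h
  have := h.apply_eq Sum.isLeft (by rintro (_ | k | k) hk <;> simp_all [link])
  simp at this

theorem link_joined_inl {F : Set (Option (E₁ ⊕ E₂))} {x y : V₁}
    (h : Joined s₁ {k | some (Sum.inl k) ∈ F} x y) :
    Joined (link p q s₁ s₂) F (Sum.inl x) (Sum.inl y) :=
  Joined.map (s := s₁) (s' := link p q s₁ s₂) (F' := F) Sum.inl
    (fun _ hk => Joined.edge (s := link p q s₁ s₂) hk) h

theorem link_joined_inr {F : Set (Option (E₁ ⊕ E₂))} {x y : V₂}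
    (h : Joined s₂ {k | some (Sum.inr k) ∈ F} x y) :
    Joined (link p q s₁ s₂) F (Sum.inr x) (Sum.inr y) :=
  Joined.map (s := s₂) (s' := link p q s₁ s₂) (F' := F) Sum.inr
    (fun _ hk => Joined.edge (s := link p q s₁ s₂) hk) h

theorem conn_link {F : Set (Option (E₁ ⊕ E₂))} (hF : none ∈ F) :
    Conn (link p q s₁ s₂) F ↔
      Conn s₁ {k | some (Sum.inl k) ∈ F} ∧ Conn s₂ {k | some (Sum.inr k) ∈ F} := by
  constructor
  · intro h
    -- Collapse one of the two parts to the vertex to which the other one is attached.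
    refine ⟨h.map (Sum.elim id fun _ => p) (fun x => ⟨Sum.inl x, rfl⟩) ?_,
      h.map (Sum.elim (fun _ => q) id) (fun x => ⟨Sum.inr x, rfl⟩) ?_⟩
    · rintro (_ | k | k) hk
      · exact Joined.refl _ _ _
      · exact Joined.edge (s := s₁) hk
      · exact Joined.refl _ _ _
    · rintro (_ | k | k) hk
      · exact Joined.refl _ _ _
      · exact Joined.refl _ _ _
      · exact Joined.edge (s := s₂) hk
  · rintro ⟨h₁, h₂⟩
    have key : ∀ x, Joined (link p q s₁ s₂) F (Sum.inl p) x := by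
      rintro (x | x)
      · exact link_joined_inl p q s₁ s₂ (h₁.2 p x)
      · exact (Joined.edge (s := link p q s₁ s₂) hF).trans
          (link_joined_inr p q s₁ s₂ (h₂.2 q x))
    exact ⟨⟨Sum.inl p⟩, fun i j => (key i).symm.trans (key j)⟩

theorem conn_link_univ :
    Conn (link p q s₁ s₂) Set.univ ↔ Conn s₁ Set.univ ∧ Conn s₂ Set.univ := by
  rw [conn_link p q s₁ s₂ (Set.mem_univ _)]; rfl

theorem none_mem_bridges_link : none ∈ bridges (link p q s₁ s₂) := fun h =>
  link_not_joined p q s₁ s₂ (by simp) p q (h.2 _ _)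

theorem bridges_link (h₁ : Conn s₁ Set.univ) (h₂ : Conn s₂ Set.univ) :
    bridges (link p q s₁ s₂) =
      insert none (some '' (Sum.inl '' bridges s₁ ∪ Sum.inr '' bridges s₂)) := by
  ext (_ | k | k)
  · simp [none_mem_bridges_link]
  · have e₁ : {l | some (Sum.inl l) ∈ ({some (Sum.inl k)}ᶜ : Set (Option (E₁ ⊕ E₂)))} = {k}ᶜ := by
      ext; simp
    have e₂ : {l | some (Sum.inr l) ∈ ({some (Sum.inl k)}ᶜ : Set (Option (E₁ ⊕ E₂)))} =
        Set.univ := by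
      ext; simp
    have : some (Sum.inl k) ∈ bridges (link p q s₁ s₂) ↔ k ∈ bridges s₁ := by
      simp only [bridges, Set.mem_ofPred_eq]
      rw [conn_link p q s₁ s₂ (by simp), e₁, e₂]
      simp [h₂]
    simp [this]
  · have e₁ : {l | some (Sum.inl l) ∈ ({some (Sum.inr k)}ᶜ : Set (Option (E₁ ⊕ E₂)))} =
        Set.univ := by
      ext; simp
    have e₂ : {l | some (Sum.inr l) ∈ ({some (Sum.inr k)}ᶜ : Set (Option (E₁ ⊕ E₂)))} = {k}ᶜ := by
      ext; simp
    have : some (Sum.inr k) ∈ bridges (link p q s₁ s₂) ↔ k ∈ bridges s₂ := by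
      simp only [bridges, Set.mem_ofPred_eq]
      rw [conn_link p q s₁ s₂ (by simp), e₁, e₂]
      simp [h₁]
    simp [this]

theorem ncard_bridges_link [Finite E₁] [Finite E₂] (h₁ : Conn s₁ Set.univ)
    (h₂ : Conn s₂ Set.univ) :
    (bridges (link p q s₁ s₂)).ncard = (bridges s₁).ncard + (bridges s₂).ncard + 1 := by
  rw [bridges_link p q s₁ s₂ h₁ h₂, Set.ncard_insert_of_notMem (by simp) (Set.toFinite _),
    Set.ncard_image_of_injective _ (Option.some_injective _),
    Set.ncard_union_eq _ (Set.toFinite _) (Set.toFinite _),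
    Set.ncard_image_of_injective _ Sum.inl_injective,
    Set.ncard_image_of_injective _ Sum.inr_injective]
  rw [Set.disjoint_left]
  rintro _ ⟨x, _, rfl⟩ ⟨y, _, h⟩
  simp at h

end Link

section Glue

variable [DecidableEq V] [DecidableEq E]

/-- A type is the disjoint union of a finite subset and its complement. -/
def split (A : Finset V) : {x // x ∈ A} ⊕ {x // x ∉ A} ≃ V := Equiv.sumCompl (· ∈ A)

/-- The multigraph on `V` assembled from a multigraph on the vertices in `A` with the edges in
`F`, a multigraph on the other vertices with the other edges, and an edge `none` between them. -/
def glue (A : Finset V) (F : Finset E) (p : {x // x ∈ A}) (q : {x // x ∉ A})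
    (s₁ : {k // k ∈ F} → {x // x ∈ A} × {x // x ∈ A})
    (s₂ : {k // k ∉ F} → {x // x ∉ A} × {x // x ∉ A}) : Option E → V × V :=
  relabel (split A) (split F).optionCongr (link p q s₁ s₂)

/-- The vertices joined to the first end point of the edge `none` after its removal. -/
def side (s : Option E → V × V) : Set V := {x | Joined s {none}ᶜ (s none).1 x}

variable (A : Finset V) (F : Finset E) (p : {x // x ∈ A}) (q : {x // x ∉ A})
    (s₁ : {k // k ∈ F} → {x // x ∈ A} × {x // x ∈ A})
    (s₂ : {k // k ∉ F} → {x // x ∉ A} × {x // x ∉ A})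

theorem glue_none : glue A F p q s₁ s₂ none = (p.1, q.1) := rfl

theorem glue_of_mem (k : {k // k ∈ F}) :
    glue A F p q s₁ s₂ (some k.1) = ((s₁ k).1.1, (s₁ k).2.1) := by
  have : (split F).optionCongr.symm (some k.1) = some (Sum.inl k) := by
    rw [Equiv.symm_apply_eq]; rfl
  simp only [glue, relabel, this, link]
  rfl

theorem glue_of_notMem (k : {k // k ∉ F}) :
    glue A F p q s₁ s₂ (some k.1) = ((s₂ k).1.1, (s₂ k).2.1) := by
  have : (split F).optionCongr.symm (some k.1) = some (Sum.inr k) := by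
    rw [Equiv.symm_apply_eq]; rfl
  simp only [glue, relabel, this, link]
  rfl

theorem conn_glue :
    Conn (glue A F p q s₁ s₂) Set.univ ↔ Conn s₁ Set.univ ∧ Conn s₂ Set.univ := by
  rw [glue, conn_relabel, Set.preimage_univ, conn_link_univ]

theorem none_mem_bridges_glue : none ∈ bridges (glue A F p q s₁ s₂) := by
  rw [glue, bridges_relabel]
  exact ⟨none, none_mem_bridges_link _ _ _ _, rfl⟩

theorem ncard_bridges_glue [Finite E] (h₁ : Conn s₁ Set.univ)
    (h₂ : Conn s₂ Set.univ) :
    (bridges (glue A F p q s₁ s₂)).ncard = (bridges s₁).ncard + (bridges s₂).ncard + 1 := by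
  rw [glue, ncard_bridges_relabel, ncard_bridges_link _ _ _ _ h₁ h₂]

theorem side_glue (h₁ : Conn s₁ Set.univ) : side (glue A F p q s₁ s₂) = A := by
  ext x
  constructor
  · intro h
    have := Joined.apply_eq (· ∈ A) ?_ h
    · simpa [glue_none] using this
    · rintro (_ | k) hk
      · simp at hk
      · by_cases hkF : k ∈ F
        · have := glue_of_mem A F p q s₁ s₂ ⟨k, hkF⟩
          simp [this]
        · have := glue_of_notMem A F p q s₁ s₂ ⟨k, hkF⟩
          simp only [this, eq_iff_iff]
          exact iff_of_false (s₂ ⟨k, hkF⟩).1.2 (s₂ ⟨k, hkF⟩).2.2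
  · intro h
    refine (h₁.2 p ⟨x, h⟩).map (s' := glue A F p q s₁ s₂) Subtype.val fun k _ => ?_
    have := Joined.edge (s := glue A F p q s₁ s₂) (F := {none}ᶜ) (k := some k.1) (by simp)
    rwa [glue_of_mem] at this

theorem glue_injective : Function.Injective
    fun t : ({x // x ∈ A} × {x // x ∉ A}) × ({k // k ∈ F} → {x // x ∈ A} × {x // x ∈ A}) ×
      ({k // k ∉ F} → {x // x ∉ A} × {x // x ∉ A}) => glue A F t.1.1 t.1.2 t.2.1 t.2.2 := by
  rintro ⟨⟨p, q⟩, s₁, s₂⟩ ⟨⟨p', q'⟩, s₁', s₂'⟩ h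
  have h0 := congrFun h none
  simp only [glue_none, Prod.mk.injEq] at h0
  have h1 : s₁ = s₁' := by
    funext k
    have := congrFun h (some k.1)
    simp only [glue_of_mem, Prod.mk.injEq] at this
    exact Prod.ext (Subtype.ext this.1) (Subtype.ext this.2)
  have h2 : s₂ = s₂' := by
    funext k
    have := congrFun h (some k.1)
    simp only [glue_of_notMem, Prod.mk.injEq] at this
    exact Prod.ext (Subtype.ext this.1) (Subtype.ext this.2)
  simp [h1, h2, Subtype.ext h0.1, Subtype.ext h0.2]

/-- A connected graph for which `none` is a bridge is assembled by `glue`. -/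
theorem exists_glue_eq {s : Option E → V × V} (hs : Conn s Set.univ) (hn : none ∈ bridges s)
    (hA : side s = A) (hF : ∀ k, k ∈ F ↔ (s (some k)).1 ∈ A) :
    ∃ p q s₁ s₂, glue A F p q s₁ s₂ = s := by
  have hA' : ∀ x, x ∈ A ↔ Joined s {none}ᶜ (s none).1 x := fun x => by
    rw [← Finset.mem_coe, ← hA]; rfl
  have h1 : (s none).1 ∈ A := (hA' _).2 (Joined.refl _ _ _)
  have h2 : (s none).2 ∉ A := by
    intro h
    rw [hA'] at h
    refine hn (hs.map id Function.surjective_id ?_)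
    rintro (_ | k) _
    · exact h
    · exact Joined.edge (s := s) (by simp)
  have h3 : ∀ k, (s (some k)).1 ∈ A ↔ (s (some k)).2 ∈ A := by
    intro k
    have := Joined.edge (s := s) (F := {none}ᶜ) (k := some k) (by simp)
    rw [hA', hA']
    exact ⟨fun h => h.trans this, fun h => h.trans this.symm⟩
  refine ⟨⟨_, h1⟩, ⟨_, h2⟩, fun k => (⟨(s (some k.1)).1, (hF _).1 k.2⟩,
    ⟨(s (some k.1)).2, (h3 _).1 ((hF _).1 k.2)⟩), fun k => (⟨(s (some k.1)).1, mt (hF _).2 k.2⟩,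
    ⟨(s (some k.1)).2, mt (h3 _).2 (mt (hF _).2 k.2)⟩), ?_⟩
  funext k
  rcases k with _ | k
  · rfl
  · by_cases hk : k ∈ F
    · exact glue_of_mem A F _ _ _ _ ⟨k, hk⟩
    · exact glue_of_notMem A F _ _ _ _ ⟨k, hk⟩

end Glue

end Multigraphs

/-! ### Sums over connected graphs with a given number of bridges -/

section GraphSums

variable {L : Type*} [Fintype L] [DecidableEq L] {B : Type*} [CommRing B] [Algebra ℂ B]
  {V W E E' : Type} [Fintype V] [Fintype W] [Fintype E] [Fintype E'] [DecidableEq V]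
  [DecidableEq W] (G : Matrix L L ℂ) (f : S L →ₗ[ℂ] B)

/-- `join` as a bilinear map. -/
def joinBilin : (S L →ₗ[ℂ] B) →ₗ[ℂ] (S L →ₗ[ℂ] B) →ₗ[ℂ] (S L →ₗ[ℂ] B) :=
  LinearMap.mk₂ ℂ (join G)
    (fun f f' g => by
      simp only [join, mulT, TensorProduct.map_add_left, LinearMap.comp_add, LinearMap.add_comp])
    (fun c f g => by
      simp only [join, mulT, TensorProduct.map_smul_left, LinearMap.comp_smul,
        LinearMap.smul_comp])
    (fun f g g' => by
      simp only [join, mulT, TensorProduct.map_add_right, LinearMap.comp_add,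
        LinearMap.add_comp])
    (fun c f g => by
      simp only [join, mulT, TensorProduct.map_smul_right, LinearMap.comp_smul,
        LinearMap.smul_comp])

theorem joinBilin_apply (f g : S L →ₗ[ℂ] B) : joinBilin G f g = join G f g := rfl

/-- The value of the graph with edges `s` as a function of the product of its external fields. -/
def graphVal (s : E → V × V) : S L →ₗ[ℂ] B :=
  evalV f ∘ₗ PiTensorProduct.mul (∏ k, edge G (s k).1 (s k).2) ∘ₗ (legsV L V).toLinearMap

theorem graphVal_apply (s : E → V × V) (a : S L) :
    graphVal G f s a = evalV f ((∏ k, edge G (s k).1 (s k).2) * legsV L V a) := rfl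

theorem graphVal_relabel (eV : V ≃ W) (eE : E ≃ E') (s : E → V × V) :
    graphVal G f (relabel eV eE s) = graphVal G f s := by
  refine LinearMap.ext fun a => ?_
  rw [graphVal_apply, graphVal_apply, ← evalV_place_equiv eV, map_mul (place (L := L) eV), place_equiv_legsV,
    map_prod, ← eE.prod_comp]
  simp [relabel, place_edge]

variable [DecidableEq E] [DecidableEq E']

open scoped Classical in
/-- The sum of the values of all connected graphs with numbered vertices and with numbered and
oriented edges that have `b` bridges. -/
def connSum (V E : Type) [Fintype V] [Fintype E] [DecidableEq V] [DecidableEq E] (b : ℕ) :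
    S L →ₗ[ℂ] B :=
  ∑ s : E → V × V, if Conn s Set.univ ∧ (bridges s).ncard = b then graphVal G f s else 0

open scoped Classical in
/-- As `connSum`, for graphs with `b + 1` bridges, one of which is the edge `none`. -/
def markedSum (V E : Type) [Fintype V] [Fintype E] [DecidableEq V] [DecidableEq E] (b : ℕ) :
    S L →ₗ[ℂ] B :=
  ∑ s : Option E → V × V,
    if Conn s Set.univ ∧ none ∈ bridges s ∧ (bridges s).ncard = b + 1 then graphVal G f s else 0

theorem connSum_congr (eV : V ≃ W) (eE : E ≃ E') (b : ℕ) :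
    connSum G f V E b = connSum G f W E' b := by
  classical
  refine Fintype.sum_bijective _ (bijective_relabel eV eE) _ _ fun s => ?_
  rw [conn_relabel, Set.preimage_univ, ncard_bridges_relabel, graphVal_relabel]

/-- Counting the bridges of all graphs in two ways. -/
theorem succ_smul_connSum (V : Type) [Fintype V] [DecidableEq V] (e b : ℕ) :
    (b + 1) • connSum G f V (Fin (e + 1)) (b + 1) = (e + 1) • markedSum G f V (Fin e) b := by
  classical
  have h1 : (b + 1) • connSum G f V (Fin (e + 1)) (b + 1) =
      ∑ s : Fin (e + 1) → V × V, ∑ k, if Conn s Set.univ ∧ k ∈ bridges s ∧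
        (bridges s).ncard = b + 1 then graphVal G f s else 0 := by
    rw [connSum, Finset.smul_sum]
    refine Finset.sum_congr rfl fun s _ => ?_
    by_cases h : Conn s Set.univ ∧ (bridges s).ncard = b + 1
    · have hcard : (Finset.univ.filter fun k => k ∈ bridges s).card = b + 1 := by
        rw [← h.2, Set.ncard_eq_toFinset_card']
        congr 1
        ext; simp
      have hk : ∀ k, (Conn s Set.univ ∧ k ∈ bridges s ∧ (bridges s).ncard = b + 1) ↔
          k ∈ bridges s := fun k => ⟨fun h' => h'.2.1, fun h' => ⟨h.1, h', h.2⟩⟩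
      simp only [if_pos h, hk]
      rw [← Finset.sum_filter, Finset.sum_const, hcard]
    · rw [if_neg h, smul_zero]
      exact (Finset.sum_eq_zero fun k _ => if_neg fun h' => h ⟨h'.1, h'.2.2⟩).symm
  rw [h1, Finset.sum_comm]
  have h2 : ∀ k : Fin (e + 1), (∑ s : Fin (e + 1) → V × V, if Conn s Set.univ ∧ k ∈ bridges s ∧
        (bridges s).ncard = b + 1 then graphVal G f s else 0) = markedSum G f V (Fin e) b := by
    intro k
    refine Fintype.sum_bijective _ (bijective_relabel (Equiv.refl V) (finSuccEquiv' k)) _ _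
      fun s => ?_
    rw [conn_relabel, Set.preimage_univ, ncard_bridges_relabel, graphVal_relabel,
      bridges_relabel]
    have : none ∈ finSuccEquiv' k '' bridges s ↔ k ∈ bridges s := by
      rw [← (finSuccEquiv' k).injective.mem_set_image (a := k), finSuccEquiv'_at]
    rw [this]
  simp [h2]

/-- The edges of a glued graph are the new edge and the edges of the two parts. -/
theorem prod_edge_glue (A : Finset V) (F : Finset E) (p : {x // x ∈ A}) (q : {x // x ∉ A})
    (s₁ : {k // k ∈ F} → {x // x ∈ A} × {x // x ∈ A})
    (s₂ : {k // k ∉ F} → {x // x ∉ A} × {x // x ∉ A}) :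
    ∏ k, edge G (glue A F p q s₁ s₂ k).1 (glue A F p q s₁ s₂ k).2 =
      edge G (split A (Sum.inl p)) (split A (Sum.inr q)) *
        (place (split A ∘ Sum.inl) (∏ k, edge G (s₁ k).1 (s₁ k).2) *
          place (split A ∘ Sum.inr) (∏ k, edge G (s₂ k).1 (s₂ k).2)) := by
  rw [Fintype.prod_option, ← (split F).prod_comp, Fintype.prod_sum_type, map_prod, map_prod]
  simp only [place_edge]
  refine congrArg₂ _ rfl (congrArg₂ _ ?_ ?_)
  · refine Finset.prod_congr rfl fun k _ => ?_
    rw [show split F (Sum.inl k) = k.1 from rfl, glue_of_mem]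
    rfl
  · refine Finset.prod_congr rfl fun k _ => ?_
    rw [show split F (Sum.inr k) = k.1 from rfl, glue_of_notMem]
    rfl

theorem sum_graphVal_glue (A : Finset V) (F : Finset E)
    (s₁ : {k // k ∈ F} → {x // x ∈ A} × {x // x ∈ A})
    (s₂ : {k // k ∉ F} → {x // x ∉ A} × {x // x ∉ A}) :
    ∑ t : {x // x ∈ A} × {x // x ∉ A}, graphVal G f (glue A F t.1 t.2 s₁ s₂) =
      join G (graphVal G f s₁) (graphVal G f s₂) := by
  refine LinearMap.ext fun a => ?_
  rw [graphVal, graphVal, ← sum_evalV_edge_mul G (split A) f, Fintype.sum_prod_type]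
  simp only [LinearMap.sum_apply]
  refine Finset.sum_congr rfl fun p _ => Finset.sum_congr rfl fun q _ => ?_
  rw [graphVal_apply, prod_edge_glue]

/-- Removing the marked bridge splits a graph into two connected graphs. -/
theorem markedSum_eq (b : ℕ) :
    markedSum G f V E b = ∑ A : Finset V, ∑ F : Finset E, ∑ t ∈ Finset.HasAntidiagonal.antidiagonal b,
      join G (connSum G f {x // x ∈ A} {k // k ∈ F} t.1)
        (connSum G f {x // x ∉ A} {k // k ∉ F} t.2) := by
  classical
  -- The two parts are determined by the graph.
  let sideF (s : Option E → V × V) : Finset V := Finset.univ.filter (· ∈ side s)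
  let sideE (s : Option E → V × V) : Finset E :=
    Finset.univ.filter fun k => (s (some k)).1 ∈ sideF s
  have h1 : markedSum G f V E b = ∑ A : Finset V, ∑ F : Finset E, ∑ s : Option E → V × V,
      if (Conn s Set.univ ∧ none ∈ bridges s ∧ (bridges s).ncard = b + 1) ∧ A = sideF s ∧
        F = sideE s then graphVal G f s else 0 := by
    have : ∀ A : Finset V, (∑ F : Finset E, ∑ s : Option E → V × V,
      if (Conn s Set.univ ∧ none ∈ bridges s ∧ (bridges s).ncard = b + 1) ∧ A = sideF s ∧
        F = sideE s then graphVal G f s else 0) = ∑ s : Option E → V × V, ∑ F : Finset E,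
      if (Conn s Set.univ ∧ none ∈ bridges s ∧ (bridges s).ncard = b + 1) ∧ A = sideF s ∧
        F = sideE s then graphVal G f s else 0 := fun A => Finset.sum_comm
    simp_rw [this]
    rw [Finset.sum_comm, markedSum]
    refine Finset.sum_congr rfl fun s _ => ?_
    simp only [ite_and, Finset.sum_ite_irrel, Finset.sum_const_zero, Finset.sum_ite_eq',
      Finset.mem_univ, if_true]
  rw [h1]
  refine Finset.sum_congr rfl fun A _ => Finset.sum_congr rfl fun F _ => ?_
  have hglue : ∀ p q s₁ s₂, ((Conn (glue A F p q s₁ s₂) Set.univ ∧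
      none ∈ bridges (glue A F p q s₁ s₂) ∧ (bridges (glue A F p q s₁ s₂)).ncard = b + 1) ∧
      A = sideF (glue A F p q s₁ s₂) ∧ F = sideE (glue A F p q s₁ s₂)) ↔
      (Conn s₁ Set.univ ∧ Conn s₂ Set.univ) ∧ (bridges s₁).ncard + (bridges s₂).ncard = b := by
    intro p q s₁ s₂
    rw [conn_glue]
    constructor
    · rintro ⟨⟨h, -, h'⟩, -⟩
      rw [ncard_bridges_glue A F p q s₁ s₂ h.1 h.2] at h'
      exact ⟨h, by omega⟩
    · rintro ⟨h, h'⟩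
      have hA : A = sideF (glue A F p q s₁ s₂) := by
        ext x
        simp [sideF, side_glue A F p q s₁ s₂ h.1]
      refine ⟨⟨h, none_mem_bridges_glue A F p q s₁ s₂, ?_⟩, hA, ?_⟩
      · rw [ncard_bridges_glue A F p q s₁ s₂ h.1 h.2, h']
      · ext k
        simp only [sideE, ← hA, Finset.mem_filter, Finset.mem_univ, true_and]
        by_cases hk : k ∈ F
        · have := glue_of_mem A F p q s₁ s₂ ⟨k, hk⟩
          simp [this, hk]
        · have := glue_of_notMem A F p q s₁ s₂ ⟨k, hk⟩
          simp only [this, hk, false_iff]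
          exact (s₂ ⟨k, hk⟩).1.2
  rw [← Finset.sum_of_injOn (s := Finset.univ)
    (f := fun t : ({x // x ∈ A} × {x // x ∉ A}) × ({k // k ∈ F} → {x // x ∈ A} × {x // x ∈ A}) ×
      ({k // k ∉ F} → {x // x ∉ A} × {x // x ∉ A}) =>
      if (Conn t.2.1 Set.univ ∧ Conn t.2.2 Set.univ) ∧
        (bridges t.2.1).ncard + (bridges t.2.2).ncard = b then
        graphVal G f (glue A F t.1.1 t.1.2 t.2.1 t.2.2) else 0)
    _ (glue_injective A F).injOn (by simp) ?_ ?_]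
  · rw [Fintype.sum_prod_type_right]
    simp only [Finset.sum_ite_irrel, Finset.sum_const_zero, sum_graphVal_glue]
    have hjoin : ∀ t : ℕ × ℕ, join G (connSum G f {x // x ∈ A} {k // k ∈ F} t.1)
        (connSum G f {x // x ∉ A} {k // k ∉ F} t.2) =
        ∑ u : ({k // k ∈ F} → {x // x ∈ A} × {x // x ∈ A}) ×
          ({k // k ∉ F} → {x // x ∉ A} × {x // x ∉ A}),
          if (Conn u.1 Set.univ ∧ Conn u.2 Set.univ) ∧
            ((bridges u.1).ncard, (bridges u.2).ncard) = t then
            join G (graphVal G f u.1) (graphVal G f u.2) else 0 := by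
      intro t
      rw [← joinBilin_apply, connSum, connSum, map_sum (joinBilin G), LinearMap.sum_apply,
        Fintype.sum_prod_type]
      refine Finset.sum_congr rfl fun s₁ _ => ?_
      rw [map_sum]
      refine Finset.sum_congr rfl fun s₂ _ => ?_
      by_cases h₁ : Conn s₁ Set.univ ∧ (bridges s₁).ncard = t.1
      · by_cases h₂ : Conn s₂ Set.univ ∧ (bridges s₂).ncard = t.2
        · rw [if_pos h₁, if_pos h₂, if_pos ⟨⟨h₁.1, h₂.1⟩, Prod.ext h₁.2 h₂.2⟩, joinBilin_apply]
        · rw [if_neg h₂, map_zero, if_neg]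
          rintro ⟨h, rfl⟩
          exact h₂ ⟨h.2, rfl⟩
      · rw [if_neg h₁, map_zero, LinearMap.zero_apply, if_neg]
        rintro ⟨h, rfl⟩
        exact h₁ ⟨h.1, rfl⟩
    simp only [hjoin]
    rw [Finset.sum_comm]
    refine Finset.sum_congr rfl fun u _ => ?_
    simp only [ite_and, Finset.sum_ite_irrel, Finset.sum_const_zero, Finset.sum_ite_eq,
      Finset.HasAntidiagonal.mem_antidiagonal]
  · intro s _ hs
    refine if_neg ?_
    rintro ⟨h, hA, hF⟩
    apply hs
    obtain ⟨p, q, s₁, s₂, rfl⟩ := exists_glue_eq (A := A) (F := F) h.1 h.2.1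
      (by rw [hA]; simp [sideF]) (fun k => by rw [hF, hA]; simp [sideE])
    exact ⟨((p, q), s₁, s₂), by simp, rfl⟩
  · rintro ⟨⟨p, q⟩, s₁, s₂⟩ -
    simp only [hglue]

end GraphSums

/-! ### Symmetry factors and the recursion in the number of bridges -/

section Normalization

variable {L : Type*} [Fintype L] [DecidableEq L] {B : Type*} [CommRing B] [Algebra ℂ B]
  (G : Matrix L L ℂ) (f : S L →ₗ[ℂ] B)

/-- The sum of all connected graphs with `v` vertices, `e` internal edges and `b` bridges, each
weighted by the inverse of its symmetry factor. -/
def connGraphs (v e b : ℕ) : S L →ₗ[ℂ] B :=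
  (1 / ((v.factorial : ℂ) * (e.factorial : ℂ) * 2 ^ e)) • connSum G f (Fin v) (Fin e) b

/-- A sum over subsets that depends only on their cardinality and that of their complement. -/
theorem sum_finset_card {M : Type*} [AddCommMonoid M] (n : ℕ) (h : ℕ → ℕ → M) :
    ∑ A : Finset (Fin n), h A.card (n - A.card) =
      ∑ t ∈ Finset.HasAntidiagonal.antidiagonal n, n.choose t.1 • h t.1 t.2 := by
  rw [← Finset.powerset_univ, Finset.sum_powerset_apply_card (fun m => h m (n - m)),
    Finset.card_fin, Finset.Nat.sum_antidiagonal_eq_sum_range_succ_mk]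

/-- Renaming the vertices and edges of the two parts by numbers. -/
theorem markedSum_fin (v e b : ℕ) :
    markedSum G f (Fin v) (Fin e) b = ∑ t ∈ Finset.HasAntidiagonal.antidiagonal v,
      ∑ u ∈ Finset.HasAntidiagonal.antidiagonal e, ∑ w ∈ Finset.HasAntidiagonal.antidiagonal b,
        (v.choose t.1 * e.choose u.1) • join G (connSum G f (Fin t.1) (Fin u.1) w.1)
          (connSum G f (Fin t.2) (Fin u.2) w.2) := by
  have key : ∀ (A : Finset (Fin v)) (F : Finset (Fin e)) (w : ℕ × ℕ),
      join G (connSum G f {x // x ∈ A} {k // k ∈ F} w.1)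
        (connSum G f {x // x ∉ A} {k // k ∉ F} w.2) =
      join G (connSum G f (Fin A.card) (Fin F.card) w.1)
        (connSum G f (Fin (v - A.card)) (Fin (e - F.card)) w.2) := by
    intro A F w
    have eA : {x // x ∉ A} ≃ Fin (v - A.card) :=
      Fintype.equivFinOfCardEq (by simp [Fintype.card_subtype_compl])
    have eF : {k // k ∉ F} ≃ Fin (e - F.card) :=
      Fintype.equivFinOfCardEq (by simp [Fintype.card_subtype_compl])
    rw [connSum_congr G f A.equivFin F.equivFin, connSum_congr G f eA eF]
  rw [markedSum_eq]
  simp only [key]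
  rw [sum_finset_card v fun m m' => ∑ F : Finset (Fin e),
    ∑ w ∈ Finset.HasAntidiagonal.antidiagonal b,
      join G (connSum G f (Fin m) (Fin F.card) w.1) (connSum G f (Fin m') (Fin (e - F.card)) w.2)]
  refine Finset.sum_congr rfl fun t _ => ?_
  rw [sum_finset_card e fun m m' => ∑ w ∈ Finset.HasAntidiagonal.antidiagonal b,
      join G (connSum G f (Fin t.1) (Fin m) w.1) (connSum G f (Fin t.2) (Fin m') w.2)]
  simp only [Finset.smul_sum, mul_smul]

/-- Cutting a bridge: a connected graph with `b + 1` bridges arises in `b + 1` ways from two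
connected graphs with `b` bridges in total, joined by an edge. -/
theorem connGraphs_succ (v e b : ℕ) :
    ((b : ℂ) + 1) • connGraphs G f v (e + 1) (b + 1) =
      (1 / 2 : ℂ) • ∑ t ∈ Finset.HasAntidiagonal.antidiagonal v,
        ∑ u ∈ Finset.HasAntidiagonal.antidiagonal e, ∑ w ∈ Finset.HasAntidiagonal.antidiagonal b,
          join G (connGraphs G f t.1 u.1 w.1) (connGraphs G f t.2 u.2 w.2) := by
  have h := succ_smul_connSum G f (Fin v) e b
  rw [← Nat.cast_smul_eq_nsmul ℂ, ← Nat.cast_smul_eq_nsmul ℂ (e + 1), Nat.cast_succ,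
    Nat.cast_succ] at h
  rw [connGraphs, smul_comm, h, markedSum_fin]
  simp only [Finset.smul_sum]
  refine Finset.sum_congr rfl fun t ht => Finset.sum_congr rfl fun u hu =>
    Finset.sum_congr rfl fun w _ => ?_
  rw [Finset.HasAntidiagonal.mem_antidiagonal] at ht hu
  obtain ⟨v₁, v₂⟩ := t
  obtain ⟨e₁, e₂⟩ := u
  dsimp only at ht hu ⊢
  subst ht hu
  simp only [connGraphs, ← joinBilin_apply, map_smul, LinearMap.smul_apply, smul_smul]
  rw [← Nat.cast_smul_eq_nsmul ℂ, smul_smul]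
  congr 1
  have hv : ((v₁ + v₂).choose v₁ : ℂ) * v₁.factorial * v₂.factorial = (v₁ + v₂).factorial := by
    rw [Nat.choose_symm_add]
    exact_mod_cast Nat.add_choose_mul_factorial_mul_factorial v₁ v₂
  have he : ((e₁ + e₂).choose e₁ : ℂ) * e₁.factorial * e₂.factorial = (e₁ + e₂).factorial := by
    rw [Nat.choose_symm_add]
    exact_mod_cast Nat.add_choose_mul_factorial_mul_factorial e₁ e₂
  have hn : ∀ n : ℕ, (n.factorial : ℂ) ≠ 0 := fun n => by exact_mod_cast n.factorial_ne_zero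
  have h1 := hn v₁
  have h2 := hn v₂
  have h3 := hn e₁
  have h4 := hn e₂
  have h5 : ((v₁ + v₂).choose v₁ : ℂ) ≠ 0 := by
    exact_mod_cast (Nat.choose_pos (Nat.le_add_right _ _)).ne'
  have h6 : ((e₁ + e₂).choose e₁ : ℂ) ≠ 0 := by
    exact_mod_cast (Nat.choose_pos (Nat.le_add_right _ _)).ne'
  have h7 : ((e₁ : ℂ) + e₂ + 1) ≠ 0 := by exact_mod_cast Nat.succ_ne_zero (e₁ + e₂)
  rw [Nat.factorial_succ, Nat.cast_mul, ← hv, ← he]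
  push_cast
  field_simp
  ring

theorem connSum_eq_zero_of_card_lt {V E : Type} [Fintype V] [Fintype E] [DecidableEq V]
    [DecidableEq E] {b : ℕ} (h : Fintype.card E < b) : connSum G f V E b = 0 := by
  refine Finset.sum_eq_zero fun s _ => if_neg ?_
  rintro ⟨-, rfl⟩
  have := Set.ncard_le_card (bridges s)
  rw [Nat.card_eq_fintype_card] at this
  omega

theorem connGraphs_eq_zero_of_lt {v e b : ℕ} (h : e < b) : connGraphs G f v e b = 0 := by
  rw [connGraphs, connSum_eq_zero_of_card_lt G f (by simpa using h), smul_zero]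

/-- `Conn` agrees with connectedness of the underlying simple graph. -/
theorem connected_skeleton_iff {v e : ℕ} (s : Fin e → Fin v × Fin v) (p : Fin e → Prop) :
    (skeleton s p).Connected ↔ Conn s {k | p k} := by
  have key : ∀ i j, (skeleton s p).Reachable i j ↔ Joined s {k | p k} i j := by
    intro i j
    constructor
    · rintro ⟨w⟩
      induction w with
      | nil => exact Joined.refl _ _ _
      | cons h _ ih =>
        refine Joined.trans ?_ ih
        rcases h with ⟨-, ⟨k, hk, h⟩ | ⟨k, hk, h⟩⟩
        · exact Relation.EqvGen.rel _ _ ⟨k, hk, h⟩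
        · exact (Relation.EqvGen.rel _ _ ⟨k, hk, h⟩ : Joined s _ _ _).symm
    · intro h
      induction h with
      | rel i j h =>
        obtain ⟨k, hk, h⟩ := h
        by_cases hij : i = j
        · rw [hij]
        · exact SimpleGraph.Adj.reachable ⟨hij, Or.inl ⟨k, hk, h⟩⟩
      | refl i => exact SimpleGraph.Reachable.refl _
      | symm i j _ ih => exact ih.symm
      | trans i j k _ _ ih ih' => exact ih.trans ih'
  rw [SimpleGraph.connected_iff, SimpleGraph.Preconnected, Conn, and_comm]
  simp only [key]

theorem edgeSet_skeleton_subset {v e : ℕ} (s : Fin e → Fin v × Fin v) (p : Fin e → Prop) :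
    (skeleton s p).edgeSet ⊆ (fun k => s((s k).1, (s k).2)) '' {k | p k} := by
  intro z
  induction z using Sym2.ind with
  | _ i j =>
    rintro ⟨-, ⟨k, hk, h⟩ | ⟨k, hk, h⟩⟩
    · exact ⟨k, hk, by simp [h]⟩
    · exact ⟨k, hk, by simp [h, Sym2.eq_swap]⟩

/-- A connected graph has at most one more vertex than it has edges. -/
theorem Conn.card_le {v e : ℕ} {s : Fin e → Fin v × Fin v} {F : Set (Fin e)} (h : Conn s F) :
    v ≤ F.ncard + 1 := by
  have h' := ((connected_skeleton_iff s (· ∈ F)).2 h).card_vert_le_card_edgeSet_add_one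
  rw [Nat.card_fin] at h'
  have h1 := Set.ncard_le_ncard (edgeSet_skeleton_subset s (· ∈ F)) (Set.toFinite _)
  have h2 := Set.ncard_image_le (f := fun k => s((s k).1, (s k).2)) (Set.toFinite {k | k ∈ F})
  rw [← Nat.card_coe_set_eq (skeleton s _).edgeSet] at h1
  exact h'.trans (Nat.add_le_add_right (h1.trans h2) 1)

theorem connGraphs_eq_zero_of_lt_card {v e b : ℕ} (h : e + 1 < v) :
    connGraphs G f v e b = 0 := by
  rw [connGraphs, connSum, Finset.sum_eq_zero, smul_zero]
  intro s _
  refine if_neg fun hs => ?_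
  have := hs.1.card_le
  rw [Set.ncard_univ, Nat.card_fin] at this
  omega

theorem connGraphs_zero_vertices (e b : ℕ) : connGraphs G f 0 e b = 0 := by
  rw [connGraphs, connSum, Finset.sum_eq_zero, smul_zero]
  intro s _
  exact if_neg fun hs => hs.1.1.elim fun i => i.elim0

end Normalization

/-! ### The recursion for the tree sums -/

section TreeRecursion

variable {L : Type*} {B : Type*} [CommRing B] [Algebra ℂ B]

/-- `f₁ ⊗ ⋯ ⊗ f_v` for a family of linear maps. -/
def multiEval {v : ℕ} (f : Fin v → S L →ₗ[ℂ] B) : SPow L v →ₗ[ℂ] B :=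
  PiTensorProduct.lift ((MultilinearMap.mkPiAlgebra ℂ (Fin v) B).compLinearMap f)

theorem multiEval_tprod {v : ℕ} (f : Fin v → S L →ₗ[ℂ] B) (a : Fin v → S L) :
    multiEval f (PiTensorProduct.tprod ℂ a) = ∏ i, f i (a i) := by
  simp [multiEval]

/-- The two factors produced by the coproduct in `copAt i`, as a map from `S(V) ⊗ S(V)`. -/
def pairAt (L : Type*) {v : ℕ} (i : Fin (v + 1)) : S L ⊗[ℂ] S L →ₐ[ℂ] SPow L (v + 2) :=
  Algebra.TensorProduct.lift (slot i.castSucc) (slot i.succ) (fun _ _ => Commute.all _ _)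

/-- With `succAbove` relative to the position `i`, the factors other than `i` are those to which
`copAt i` applies no coproduct, and `i` itself is sent to `i + 1`. -/
theorem copAt_tprod {v : ℕ} (i : Fin (v + 1)) (a : Fin (v + 1) → S L) :
    copAt i (PiTensorProduct.tprod ℂ a) = pairAt L i (cop L (a i)) *
      ∏ j ∈ Finset.univ.erase i, put (i.castSucc.succAbove j) (a j) := by
  rw [copAt, PiTensorProduct.lift.tprod, MultilinearMap.compLinearMap_apply,
    MultilinearMap.mkPiAlgebra_apply, ← Finset.mul_prod_erase _ _ (Finset.mem_univ i)]
  congr 1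
  · simp [pairAt]
  · refine Finset.prod_congr rfl fun j hj => ?_
    rcases lt_or_gt_of_ne (Finset.ne_of_mem_erase hj) with h | h
    · rw [if_pos h, Fin.succAbove_of_castSucc_lt _ _ (by simpa using h)]
      rfl
    · rw [if_neg h.not_gt, if_neg h.ne', Fin.succAbove_of_lt_succ _ _
        (by rw [Fin.castSucc_lt_succ_iff]; exact h.le)]
      rfl

theorem evalV_pairAt_mul {v : ℕ} (f : S L →ₗ[ℂ] B) (i : Fin (v + 1)) (a : Fin (v + 1) → S L)
    (w : S L ⊗[ℂ] S L) :
    tensorEval f (v + 2) (pairAt L i w *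
      ∏ j ∈ Finset.univ.erase i, put (i.castSucc.succAbove j) (a j)) =
      mulT f f w * ∏ j ∈ Finset.univ.erase i, f (a j) := by
  have hext : tensorEval f (v + 2) ∘ₗ PiTensorProduct.mul
      (∏ j ∈ Finset.univ.erase i, put (i.castSucc.succAbove j) (a j)) ∘ₗ
      (pairAt L i).toLinearMap = LinearMap.mul ℂ B (∏ j ∈ Finset.univ.erase i, f (a j)) ∘ₗ
        mulT f f := by
    refine TensorProduct.ext' fun b c => ?_
    simp only [LinearMap.comp_apply, AlgHom.toLinearMap_apply, ← PiTensorProduct.mul_def,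
      LinearMap.mul_apply', mulT_tmul, pairAt, Algebra.TensorProduct.lift_tmul]
    -- The tensor with `b` in the factor `i`, `c` in the factor `i + 1` and `a` elsewhere.
    obtain ⟨a', hb, hc, ha⟩ : ∃ a' : Fin (v + 2) → S L, a' i.castSucc = b ∧ a' i.succ = c ∧
        ∀ j ∈ Finset.univ.erase i, a' (i.castSucc.succAbove j) = a j := by
      refine ⟨Fin.insertNth (α := fun _ => S L) i.castSucc b (Function.update a i c),
        by simp, ?_, fun j hj => ?_⟩
      · have := Fin.insertNth_apply_succAbove (α := fun _ => S L) i.castSucc b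
          (Function.update a i c) i
        rwa [Fin.succAbove_castSucc_self, Function.update_self] at this
      · rw [Fin.insertNth_apply_succAbove, Function.update_of_ne (Finset.ne_of_mem_erase hj)]
    have h := evalV_prod_put f a'
    rw [Fin.prod_univ_succAbove _ i.castSucc, Fin.prod_univ_succAbove _ i.castSucc,
      ← Finset.mul_prod_erase _ _ (Finset.mem_univ i),
      ← Finset.mul_prod_erase _ _ (Finset.mem_univ i), Fin.succAbove_castSucc_self, hb, hc,
      Finset.prod_congr rfl (fun j hj => by rw [ha j hj]),
      Finset.prod_congr (s₁ := Finset.univ.erase i) (f := fun j => f _) rfl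
        (fun j hj => by rw [ha j hj])] at h
    have e₃ : (∏ j ∈ Finset.univ.erase i, put (i.castSucc.succAbove j) (a j)) *
        (slot i.castSucc b * slot i.succ c) = put i.castSucc b * (put i.succ c *
          ∏ j ∈ Finset.univ.erase i, put (i.castSucc.succAbove j) (a j)) := by
      rw [mul_comm, mul_assoc]
      rfl
    rw [e₃]
    refine Eq.trans h ?_
    rw [← mul_assoc, mul_comm]
  rw [mul_comm (pairAt L i w), mul_comm (mulT f f w)]
  exact LinearMap.congr_fun hext w

variable [Fintype L] [DecidableEq L] (G : Matrix L L ℂ)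

/-- The transpose of `Q_i` replaces the linear map at the vertex `i` by `½ join`. -/
theorem tensorEval_Q {v : ℕ} (f : S L →ₗ[ℂ] B) (i : Fin (v + 1)) (t : SPow L (v + 1)) :
    tensorEval f (v + 2) (Q G i t) =
      (1 / 2 : ℂ) • multiEval (fun j => if j = i then join G f f else f) t := by
  have hR : R G i.castSucc i.succ = pairAt L i (edgeT G) := by
    simp [R, edgeT, pairAt]
  have : tensorEval f (v + 2) ∘ₗ Q G i =
      (1 / 2 : ℂ) • multiEval (fun j => if j = i then join G f f else f) := by
    refine PiTensorProduct.ext (MultilinearMap.ext fun a => ?_)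
    rw [LinearMap.compMultilinearMap_apply, LinearMap.compMultilinearMap_apply,
      LinearMap.smul_apply, multiEval_tprod, LinearMap.comp_apply, Q, LinearMap.smul_apply,
      map_smul, LinearMap.comp_apply, copAt_tprod, ← PiTensorProduct.mul_def, hR, ← mul_assoc,
      ← map_mul, evalV_pairAt_mul, ← Finset.mul_prod_erase _ _ (Finset.mem_univ i), if_pos rfl]
    congr 2
    exact Finset.prod_congr rfl fun j hj => by rw [if_neg (Finset.ne_of_mem_erase hj)]
  exact LinearMap.congr_fun this t

omit [Algebra ℂ B] [Fintype L] [DecidableEq L] in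
/-- The product rule over the dual numbers. -/
theorem prod_inl_add_inr {ι : Type*} [DecidableEq ι] (s : Finset ι) (x y : ι → B) :
    ∏ i ∈ s, (TrivSqZeroExt.inl (x i) + TrivSqZeroExt.inr (y i) : DualNumber B) =
      TrivSqZeroExt.inl (∏ i ∈ s, x i) +
        TrivSqZeroExt.inr (∑ i ∈ s, ∏ j ∈ s, if j = i then y j else x j) := by
  induction s using Finset.induction_on with
  | empty => simp
  | insert a s ha ih =>
    rw [Finset.prod_insert ha, ih, Finset.prod_insert ha, Finset.sum_insert ha,
      Finset.prod_insert ha, if_pos rfl]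
    have h1 : ∏ j ∈ s, (if j = a then y j else x j) = ∏ j ∈ s, x j :=
      Finset.prod_congr rfl fun j hj => if_neg (by rintro rfl; exact ha hj)
    have h2 : ∑ i ∈ s, ∏ j ∈ insert a s, (if j = i then y j else x j) =
        x a * ∑ i ∈ s, ∏ j ∈ s, if j = i then y j else x j := by
      rw [Finset.mul_sum]
      refine Finset.sum_congr rfl fun i hi => ?_
      rw [Finset.prod_insert ha, if_neg (by rintro rfl; exact ha hi)]
    rw [h1, h2]
    ext
    · simp
    · simp [mul_comm]; ring

/-- The linear map `f + ε g` over the dual numbers. -/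
def perturb (f g : S L →ₗ[ℂ] B) : S L →ₗ[ℂ] DualNumber B where
  toFun a := TrivSqZeroExt.inl (f a) + TrivSqZeroExt.inr (g a)
  map_add' a b := by ext <;> simp
  map_smul' c a := by ext <;> simp

omit [Fintype L] [DecidableEq L] in
theorem perturb_apply (f g : S L →ₗ[ℂ] B) (a : S L) :
    perturb f g a = TrivSqZeroExt.inl (f a) + TrivSqZeroExt.inr (g a) := rfl

omit [Fintype L] [DecidableEq L] in
theorem tensorEval_perturb (f g : S L →ₗ[ℂ] B) {v : ℕ} (t : SPow L v) :
    tensorEval (perturb f g) v t = TrivSqZeroExt.inl (tensorEval f v t) +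
      TrivSqZeroExt.inr (∑ i, multiEval (fun j => if j = i then g else f) t) := by
  induction t using PiTensorProduct.induction_on with
  | smul_tprod c a =>
    have : tensorEval (perturb f g) v (PiTensorProduct.tprod ℂ a) =
        TrivSqZeroExt.inl (tensorEval f v (PiTensorProduct.tprod ℂ a)) +
      TrivSqZeroExt.inr (∑ i, multiEval (fun j => if j = i then g else f)
        (PiTensorProduct.tprod ℂ a)) := by
      simp only [multiEval_tprod]
      have h1 : tensorEval (perturb f g) v (PiTensorProduct.tprod ℂ a) =
        ∏ i, perturb f g (a i) := by simp [tensorEval]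
      have h2 : tensorEval f v (PiTensorProduct.tprod ℂ a) = ∏ i, f (a i) := by
        simp [tensorEval]
      rw [h1, h2]
      simp only [perturb_apply]
      rw [prod_inl_add_inr]
      congr 2
      refine Finset.sum_congr rfl fun i _ => Finset.prod_congr rfl fun j _ => ?_
      split_ifs <;> rfl
    rw [map_smul, this]
    ext <;> simp [Finset.smul_sum]
  | add s t hs ht =>
    rw [map_add, hs, ht]
    ext <;> simp [Finset.sum_add_distrib]

theorem join_perturb (f f' g g' : S L →ₗ[ℂ] B) :
    join G (perturb f f') (perturb g g') =
      perturb (join G f g) (join G f g' + join G f' g) := by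
  have key : ∀ w, mulT (perturb f f') (perturb g g') w =
      TrivSqZeroExt.inl (mulT f g w) + TrivSqZeroExt.inr (mulT f g' w + mulT f' g w) := by
    intro w
    induction w using TensorProduct.induction_on with
    | zero => simp
    | tmul a b =>
      simp only [mulT_tmul, perturb_apply]
      ext
      · simp
      · simp [mul_comm]
    | add s t hs ht =>
      simp only [map_add, hs, ht]
      ext
      · simp
      · simp; ring
  exact LinearMap.ext fun a => key _

/-- The tree sum `f^{⊗(v+1)} ∘ Ω^{0,v+1}`. -/
def treeSum (f : S L →ₗ[ℂ] B) (v : ℕ) : S L →ₗ[ℂ] B := tensorEval f (v + 1) ∘ₗ OmegaTree G v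

theorem treeSum_zero (f : S L →ₗ[ℂ] B) : treeSum G f 0 = f := by
  refine LinearMap.ext fun a => ?_
  have h : evalV f (put (0 : Fin 1) a) = f a := by
    simpa using evalV_prod_put (V := Fin 1) f (fun _ => a)
  exact h

/-- The tree sums of a perturbed vertex function in the direction `join f f`. -/
theorem treeSum_perturb (f : S L →ₗ[ℂ] B) (v : ℕ) :
    treeSum G (perturb f (join G f f)) v =
      perturb (treeSum G f v) ((2 * ((v : ℂ) + 1)) • treeSum G f (v + 1)) := by
  refine LinearMap.ext fun a => ?_
  rw [treeSum, LinearMap.comp_apply, tensorEval_perturb, perturb_apply]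
  congr 2
  have hv : ((v : ℂ) + 1) ≠ 0 := by exact_mod_cast Nat.succ_ne_zero v
  rw [LinearMap.smul_apply, treeSum, LinearMap.comp_apply, OmegaTree, LinearMap.smul_apply,
    map_smul, LinearMap.sum_apply, map_sum, smul_smul]
  simp only [LinearMap.comp_apply, tensorEval_Q, ← Finset.smul_sum, smul_smul]
  rw [show 2 * ((v : ℂ) + 1) * (1 / ((v : ℂ) + 1)) * (1 / 2) = 1 by field_simp, one_smul]

omit [Fintype L] [DecidableEq L] in
theorem perturb_injective_right {f g f' g' : S L →ₗ[ℂ] B} (h : perturb f g = perturb f' g') :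
    g = g' := by
  refine LinearMap.ext fun a => ?_
  have := congrArg TrivSqZeroExt.snd (LinearMap.congr_fun h a)
  simpa [perturb_apply] using this

/-- Cutting an edge of a tree: a tree with `v + 1` edges has `v + 1` possible cuts. -/
theorem treeSum_succ (f : S L →ₗ[ℂ] B) (v : ℕ) :
    ((v : ℂ) + 1) • treeSum G f (v + 1) = (1 / 2 : ℂ) •
      ∑ t ∈ Finset.HasAntidiagonal.antidiagonal v, join G (treeSum G f t.1) (treeSum G f t.2) := by
  induction v generalizing B with
  | zero =>
    have h := treeSum_perturb G f 0
    rw [treeSum_zero, treeSum_zero] at h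
    have h' := perturb_injective_right h
    simp only [Nat.cast_zero, zero_add, mul_one] at h'
    simp [treeSum_zero, h', smul_smul]
  | succ v ih =>
    -- The coefficient of `ε` in the induction hypothesis for `f + ε (join f f)`.
    have h := ih (perturb f (join G f f))
    simp only [treeSum_perturb, join_perturb] at h
    have h' : ∀ a, ((v : ℂ) + 1) • (2 * ((v : ℂ) + 1 + 1)) • treeSum G f (v + 1 + 1) a =
        (1 / 2 : ℂ) • ∑ t ∈ Finset.HasAntidiagonal.antidiagonal v,
          ((2 * ((t.2 : ℂ) + 1)) • join G (treeSum G f t.1) (treeSum G f (t.2 + 1)) a +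
            (2 * ((t.1 : ℂ) + 1)) • join G (treeSum G f (t.1 + 1)) (treeSum G f t.2) a) := by
      intro a
      have := congrArg TrivSqZeroExt.snd (LinearMap.congr_fun h a)
      simpa [perturb_apply, TrivSqZeroExt.snd_sum, ← joinBilin_apply] using this
    refine LinearMap.ext fun a => ?_
    set J : ℕ → ℕ → B := fun i j => join G (treeSum G f i) (treeSum G f j) a with hJ
    have s1 : ∑ t ∈ Finset.HasAntidiagonal.antidiagonal (v + 1), (t.1 : ℂ) • J t.1 t.2 =
        ∑ t ∈ Finset.HasAntidiagonal.antidiagonal v, ((t.1 : ℂ) + 1) • J (t.1 + 1) t.2 := by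
      rw [Finset.Nat.sum_antidiagonal_succ]; simp
    have s2 : ∑ t ∈ Finset.HasAntidiagonal.antidiagonal (v + 1), (t.2 : ℂ) • J t.1 t.2 =
        ∑ t ∈ Finset.HasAntidiagonal.antidiagonal v, ((t.2 : ℂ) + 1) • J t.1 (t.2 + 1) := by
      rw [Finset.Nat.sum_antidiagonal_succ']; simp
    have s3 : ((v : ℂ) + 1) • ∑ t ∈ Finset.HasAntidiagonal.antidiagonal (v + 1), J t.1 t.2 =
        ∑ t ∈ Finset.HasAntidiagonal.antidiagonal v,
          (((t.2 : ℂ) + 1) • J t.1 (t.2 + 1) + ((t.1 : ℂ) + 1) • J (t.1 + 1) t.2) := by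
      rw [Finset.sum_add_distrib, ← s1, ← s2, ← Finset.sum_add_distrib, Finset.smul_sum]
      refine Finset.sum_congr rfl fun t ht => ?_
      rw [← add_smul, ← Nat.cast_add, add_comm t.2,
        Finset.HasAntidiagonal.mem_antidiagonal.1 ht]
      push_cast; rfl
    have hv : ((v : ℂ) + 1) ≠ 0 := by exact_mod_cast Nat.succ_ne_zero v
    have h2 := h' a
    simp only [mul_smul, ← smul_add, ← Finset.smul_sum] at h2
    change _ = (1 / 2 : ℂ) • (2 : ℂ) • ∑ t ∈ Finset.HasAntidiagonal.antidiagonal v,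
          (((t.2 : ℂ) + 1) • J t.1 (t.2 + 1) + ((t.1 : ℂ) + 1) • J (t.1 + 1) t.2) at h2
    rw [← s3] at h2
    have h3 : ((v : ℂ) + 1) • ((v : ℂ) + 1 + 1) • treeSum G f (v + 1 + 1) a =
        ((v : ℂ) + 1) • (1 / 2 : ℂ) •
          ∑ t ∈ Finset.HasAntidiagonal.antidiagonal (v + 1), J t.1 t.2 := by
      have := congrArg (fun x => (1 / 2 : ℂ) • x) h2
      simp only [smul_smul] at this ⊢
      convert this using 2 <;> ring
    have h4 := smul_right_injective B hv h3
    simpa [hJ] using h4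

end TreeRecursion

/-! ### The expansion of the connected functions -/

section Expansion

/-- The sum over loop numbers as a sum over edge numbers: `m` and `n` are the numbers of edges of
spanning trees of the two parts, below which there are no connected graphs. -/
theorem sum_antidiagonal_shift {M : Type*} [AddCommMonoid M] (l m n : ℕ) (φ : ℕ → ℕ → M)
    (hφ : ∀ i j, i < m ∨ j < n → φ i j = 0) :
    ∑ t ∈ Finset.HasAntidiagonal.antidiagonal l, φ (t.1 + m) (t.2 + n) =
      ∑ t ∈ Finset.HasAntidiagonal.antidiagonal (l + m + n), φ t.1 t.2 := by
  refine Finset.sum_of_injOn (fun t => (t.1 + m, t.2 + n)) ?_ ?_ ?_ (fun t _ => rfl)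
  · rintro ⟨i, j⟩ - ⟨i', j'⟩ - h
    simpa using h
  · rintro ⟨i, j⟩ h
    simp only [Finset.mem_coe, Finset.HasAntidiagonal.mem_antidiagonal] at h ⊢
    omega
  · rintro ⟨i, j⟩ h h'
    refine hφ i j ?_
    by_contra hc
    rw [not_or, not_lt, not_lt] at hc
    simp only [Finset.HasAntidiagonal.mem_antidiagonal] at h
    refine h' ⟨(i - m, j - n), ?_, ?_⟩
    · simp only [Finset.mem_coe, Finset.HasAntidiagonal.mem_antidiagonal]
      omega
    · exact Prod.ext (Nat.sub_add_cancel hc.1) (Nat.sub_add_cancel hc.2)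

theorem sum_antidiagonal_fin_two {M : Type*} [AddCommMonoid M] (d : Fin 2 →₀ ℕ)
    (φ : ℕ → ℕ → ℕ → ℕ → M) :
    ∑ p ∈ Finset.HasAntidiagonal.antidiagonal d, φ (p.1 0) (p.1 1) (p.2 0) (p.2 1) =
      ∑ v ∈ Finset.HasAntidiagonal.antidiagonal (d 1),
        ∑ l ∈ Finset.HasAntidiagonal.antidiagonal (d 0), φ l.1 v.1 l.2 v.2 := by
  rw [← Finset.sum_product']
  refine Finset.sum_bij' (fun p _ => ((p.1 1, p.2 1), (p.1 0, p.2 0)))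
    (fun t _ => (Finsupp.equivFunOnFinite.symm ![t.2.1, t.1.1],
      Finsupp.equivFunOnFinite.symm ![t.2.2, t.1.2])) ?_ ?_ ?_ ?_ ?_
  · intro p hp
    rw [Finset.HasAntidiagonal.mem_antidiagonal] at hp
    simp [← hp]
  · rintro ⟨⟨i, j⟩, k, m⟩ h
    simp only [Finset.mem_product, Finset.HasAntidiagonal.mem_antidiagonal] at h ⊢
    ext x
    fin_cases x
    · simp [← h.2]
    · simp [← h.1]
  · intro p _
    refine Prod.ext ?_ ?_ <;> (ext x; fin_cases x <;> simp)
  · rintro ⟨⟨i, j⟩, k, m⟩ _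
    simp
  · intro p _
    rfl

variable {L : Type*} {B : Type*} [CommRing B] [Algebra ℂ B]

theorem coeff_formalSum (F : ℕ → ℕ → S L →ₗ[ℂ] ℂ) (a : S L) (d : Fin 2 →₀ ℕ) :
    MvPowerSeries.coeff d (formalSum F a) = F (d 0) (d 1) a := rfl

theorem coeff_mulT_formalSum (F F' : ℕ → ℕ → S L →ₗ[ℂ] ℂ) (w : S L ⊗[ℂ] S L)
    (d : Fin 2 →₀ ℕ) :
    MvPowerSeries.coeff d (mulT (formalSum F) (formalSum F') w) =
      ∑ p ∈ Finset.HasAntidiagonal.antidiagonal d,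
        mulT (F (p.1 0) (p.1 1)) (F' (p.2 0) (p.2 1)) w := by
  induction w using TensorProduct.induction_on with
  | zero => simp
  | tmul a b =>
    rw [mulT_tmul, MvPowerSeries.coeff_mul]
    rfl
  | add s t hs ht => simp only [map_add, hs, ht, Finset.sum_add_distrib]

variable [Fintype L] [DecidableEq L] (G : Matrix L L ℂ)

/-- `join` only sees the values on elements without constant term. -/
theorem join_congr {f f' g g' : S L →ₗ[ℂ] B}
    (hf : ∀ a, MvPolynomial.constantCoeff a = 0 → f a = f' a)
    (hg : ∀ a, MvPolynomial.constantCoeff a = 0 → g a = g' a) : join G f g = join G f' g' := by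
  refine LinearMap.ext fun a => ?_
  rw [join_apply, join_apply]
  induction cop L a using TensorProduct.induction_on with
  | zero => simp
  | tmul b c =>
    simp only [edgeT, Finset.sum_mul, map_sum, smul_mul_assoc, map_smul,
      Algebra.TensorProduct.tmul_mul_tmul, mulT_tmul]
    refine Finset.sum_congr rfl fun x _ => Finset.sum_congr rfl fun y _ => ?_
    rw [hf _ (by simp), hg _ (by simp)]
  | add s t hs ht => rw [mul_add, map_add, map_add, hs, ht]

/-- Connected graphs with `b` bridges, as a formal series. -/
def bridgeSeries (ν : S L →ₗ[ℂ] ℂ) (b : ℕ) : S L →ₗ[ℂ] Series :=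
  formalSum fun l v => connGraphs G ν v (l + v - 1) b

/-- The bridge-cutting recursion for formal series. -/
theorem bridgeSeries_succ (ν : S L →ₗ[ℂ] ℂ) (b : ℕ) :
    ((b : ℂ) + 1) • bridgeSeries G ν (b + 1) = (1 / 2 : ℂ) •
      ∑ w ∈ Finset.HasAntidiagonal.antidiagonal b,
        join G (bridgeSeries G ν w.1) (bridgeSeries G ν w.2) := by
  refine LinearMap.ext fun a => MvPowerSeries.ext fun d => ?_
  have hR : MvPowerSeries.coeff d (((1 / 2 : ℂ) • ∑ w ∈ Finset.HasAntidiagonal.antidiagonal b,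
      join G (bridgeSeries G ν w.1) (bridgeSeries G ν w.2)) a) =
      ((1 / 2 : ℂ) • ∑ v ∈ Finset.HasAntidiagonal.antidiagonal (d 1),
        ∑ l ∈ Finset.HasAntidiagonal.antidiagonal (d 0),
          ∑ w ∈ Finset.HasAntidiagonal.antidiagonal b,
            join G (connGraphs G ν v.1 (l.1 + v.1 - 1) w.1)
              (connGraphs G ν v.2 (l.2 + v.2 - 1) w.2)) a := by
    simp only [LinearMap.smul_apply, LinearMap.sum_apply, MvPowerSeries.coeff_smul, map_sum,
      join_apply, bridgeSeries, coeff_mulT_formalSum]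
    congr 1
    rw [Finset.sum_comm, ← sum_antidiagonal_fin_two d fun l v l' v' =>
      ∑ w ∈ Finset.HasAntidiagonal.antidiagonal b,
        mulT (connGraphs G ν v (l + v - 1) w.1) (connGraphs G ν v' (l' + v' - 1) w.2)
          (edgeT G * cop L a)]
  have hL : MvPowerSeries.coeff d ((((b : ℂ) + 1) • bridgeSeries G ν (b + 1)) a) =
      (((b : ℂ) + 1) • connGraphs G ν (d 1) (d 0 + d 1 - 1) (b + 1)) a := by
    simp only [LinearMap.smul_apply, MvPowerSeries.coeff_smul]
    rfl
  rw [hL, hR]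
  refine LinearMap.congr_fun ?_ a
  generalize d 0 = l
  generalize d 1 = v
  -- Graphs without vertices do not contribute.
  have hz₁ : ∀ e w (g : S L →ₗ[ℂ] ℂ), join G (connGraphs G ν 0 e w) g = 0 := fun e w g => by
    rw [connGraphs_zero_vertices, ← joinBilin_apply, map_zero, LinearMap.zero_apply]
  have hz₂ : ∀ e w (g : S L →ₗ[ℂ] ℂ), join G g (connGraphs G ν 0 e w) = 0 := fun e w g => by
    rw [connGraphs_zero_vertices, ← joinBilin_apply, map_zero]
  rcases Nat.lt_or_ge (l + v - 1) 1 with he | he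
  · rw [connGraphs_eq_zero_of_lt G ν (by omega), smul_zero, eq_comm, Finset.sum_eq_zero,
      smul_zero]
    intro t ht
    rw [Finset.HasAntidiagonal.mem_antidiagonal] at ht
    refine Finset.sum_eq_zero fun u hu => Finset.sum_eq_zero fun w _ => ?_
    obtain ⟨t₁, t₂⟩ := t
    rcases Nat.eq_zero_or_pos t₁ with rfl | h₁
    · exact hz₁ _ _ _
    · have : t₂ = 0 := by simp only at ht; omega
      subst this
      exact hz₂ _ _ _
  rcases Nat.eq_zero_or_pos v with rfl | hv
  · rw [connGraphs_zero_vertices]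
    simp [hz₁]
  obtain ⟨e, he'⟩ := Nat.exists_eq_add_of_le' he
  rw [he', connGraphs_succ]
  congr 1
  refine Finset.sum_congr rfl fun t ht => ?_
  obtain ⟨t₁, t₂⟩ := t
  rw [Finset.HasAntidiagonal.mem_antidiagonal] at ht
  dsimp only at ht ⊢
  rcases t₁ with _ | t₁
  · simp [hz₁]
  rcases t₂ with _ | t₂
  · simp [hz₂]
  have hel : e = l + t₁ + t₂ := by omega
  rw [hel, ← sum_antidiagonal_shift l t₁ t₂ fun i j =>
    ∑ w ∈ Finset.HasAntidiagonal.antidiagonal b,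
      join G (connGraphs G ν (t₁ + 1) i w.1) (connGraphs G ν (t₂ + 1) j w.2)]
  · rfl
  · intro i j h
    refine Finset.sum_eq_zero fun w _ => ?_
    rcases h with h | h
    · rw [connGraphs_eq_zero_of_lt_card (v := t₁ + 1) G ν (by omega), ← joinBilin_apply, map_zero,
        LinearMap.zero_apply]
    · rw [connGraphs_eq_zero_of_lt_card (v := t₂ + 1) G ν (by omega), ← joinBilin_apply, map_zero]

theorem isConn_iff {v e : ℕ} (s : Fin e → Fin v × Fin v) : IsConn s ↔ Conn s Set.univ :=
  connected_skeleton_iff s fun _ => True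

theorem isOnePI_iff {v e : ℕ} (s : Fin e → Fin v × Fin v) :
    IsOnePI s ↔ Conn s Set.univ ∧ (bridges s).ncard = 0 := by
  rw [IsOnePI, isConn_iff, Set.ncard_eq_zero (Set.toFinite _), Set.eq_empty_iff_forall_notMem]
  refine and_congr_right fun _ => forall_congr' fun k => ?_
  rw [connected_skeleton_iff]
  exact not_not.symm

theorem graphSum_apply (ν : S L →ₗ[ℂ] ℂ) (P : {v e : ℕ} → (Fin e → Fin v × Fin v) → Prop)
    (v e : ℕ) (a : S L) :
    open scoped Classical in
    graphSum G ν P v e a = (1 / ((v.factorial : ℂ) * (e.factorial : ℂ) * 2 ^ e)) •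
      ∑ s : Fin e → Fin v × Fin v, if P s then
        graphVal G ν s (a - MvPolynomial.C (MvPolynomial.constantCoeff a)) else 0 := by
  classical
  rw [graphSum, LinearMap.smul_apply, LinearMap.sum_apply]
  congr 1
  refine Finset.sum_congr rfl fun s _ => ?_
  split_ifs
  · have : (MvPolynomial.aeval (R := ℂ) (fun _ : L => (0 : ℂ))) a =
        MvPolynomial.constantCoeff a := by
      simp [MvPolynomial.aeval_zero']
    simp only [LinearMap.comp_apply, LinearMap.sub_apply, LinearMap.id_apply,
      AlgHom.toLinearMap_apply, this]
    rfl
  · rfl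

theorem graphSum_C (ν : S L →ₗ[ℂ] ℂ) (P : {v e : ℕ} → (Fin e → Fin v × Fin v) → Prop)
    (v e : ℕ) (c : ℂ) : graphSum G ν P v e (MvPolynomial.C c) = 0 := by
  rw [graphSum_apply]
  simp

theorem graphSum_isOnePI (ν : S L →ₗ[ℂ] ℂ) (v e : ℕ) {a : S L}
    (ha : MvPolynomial.constantCoeff a = 0) :
    graphSum G ν IsOnePI v e a = connGraphs G ν v e 0 a := by
  rw [graphSum_apply, connGraphs, LinearMap.smul_apply, connSum, LinearMap.sum_apply]
  congr 1
  refine Finset.sum_congr rfl fun s _ => ?_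
  simp only [ha, map_zero, sub_zero]
  by_cases h : IsOnePI s
  · rw [if_pos h, if_pos ((isOnePI_iff s).1 h)]
  · rw [if_neg h, if_neg (mt (isOnePI_iff s).2 h), LinearMap.zero_apply]

theorem graphSum_isConn (ν : S L →ₗ[ℂ] ℂ) (v e : ℕ) {a : S L}
    (ha : MvPolynomial.constantCoeff a = 0) :
    graphSum G ν IsConn v e a = ∑ b ∈ Finset.range (e + 1), connGraphs G ν v e b a := by
  classical
  simp only [connGraphs, LinearMap.smul_apply, ← Finset.smul_sum, connSum, LinearMap.sum_apply]
  rw [graphSum_apply, Finset.sum_comm]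
  congr 1
  refine Finset.sum_congr rfl fun s _ => ?_
  have hb : (bridges s).ncard ∈ Finset.range (e + 1) := by
    have := Set.ncard_le_card (bridges s)
    rw [Nat.card_fin] at this
    exact Finset.mem_range.2 (by omega)
  rw [Finset.sum_eq_single_of_mem _ hb]
  · simp only [isConn_iff, ha, map_zero, sub_zero, and_true]
    split_ifs <;> rfl
  · intro b _ hne
    rw [if_neg fun h => hne h.2.symm, LinearMap.zero_apply]

theorem onePI_apply (ν : S L →ₗ[ℂ] ℂ) {a : S L} (ha : MvPolynomial.constantCoeff a = 0) :
    onePI G ν a = bridgeSeries G ν 0 a :=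
  MvPowerSeries.ext fun d => graphSum_isOnePI G ν (d 1) (d 0 + d 1 - 1) ha

theorem onePI_C (ν : S L →ₗ[ℂ] ℂ) (c : ℂ) : onePI G ν (MvPolynomial.C c) = 0 :=
  MvPowerSeries.ext fun d => graphSum_C G ν IsOnePI (d 1) (d 0 + d 1 - 1) c

/-- Trees of 1PI functions with `b` edges are connected graphs with `b` bridges, if there are
external edges: the constant term of `onePI` is zero by convention, that of `bridgeSeries` is
not. -/
theorem treeSum_onePI (ν : S L →ₗ[ℂ] ℂ) (b : ℕ) :
    ∀ a, MvPolynomial.constantCoeff a = 0 →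
      treeSum G (onePI G ν) b a = bridgeSeries G ν b a := by
  induction b using Nat.strong_induction_on with
  | _ b ih =>
    rcases b with _ | b
    · intro a ha
      rw [treeSum_zero, onePI_apply G ν ha]
    · intro a _
      have hb : ((b : ℂ) + 1) ≠ 0 := by exact_mod_cast Nat.succ_ne_zero b
      have : treeSum G (onePI G ν) (b + 1) = bridgeSeries G ν (b + 1) := by
        refine smul_right_injective _ hb ?_
        simp only [treeSum_succ, bridgeSeries_succ]
        congr 1
        refine Finset.sum_congr rfl fun w hw => ?_
        rw [Finset.HasAntidiagonal.mem_antidiagonal] at hw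
        exact join_congr G (ih w.1 (by omega)) (ih w.2 (by omega))
      rw [this]

theorem hasSum_bridgeSeries (ν : S L →ₗ[ℂ] ℂ) {a : S L}
    (ha : MvPolynomial.constantCoeff a = 0) :
    HasSum (fun b => bridgeSeries G ν b a)
      (formalSum (fun l v => graphSum G ν IsConn v (l + v - 1)) a) := by
  rw [MvPowerSeries.WithPiTopology.hasSum_iff_hasSum_coeff]
  intro d
  rw [coeff_formalSum, graphSum_isConn G ν _ _ ha]
  refine hasSum_sum_of_ne_finset_zero (f := fun b => connGraphs G ν (d 1) (d 0 + d 1 - 1) b a)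
    fun b hb => ?_
  have hb' := mt Finset.mem_range.2 hb
  rw [connGraphs_eq_zero_of_lt G ν (by omega), LinearMap.zero_apply]

theorem hasSum_sigmaTerm (ν : S L →ₗ[ℂ] ℂ) {a : S L}
    (ha : MvPolynomial.constantCoeff a = 0) :
    HasSum (fun v => sigmaTerm G (onePI G ν) v a)
      (formalSum (fun l v => graphSum G ν IsConn v (l + v - 1)) a) := by
  have h : (fun v => sigmaTerm G (onePI G ν) v a) = fun b => bridgeSeries G ν b a :=
    funext fun b => treeSum_onePI G ν b a ha
  rw [h]
  exact hasSum_bridgeSeries G ν ha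

theorem join_one (f g : S L →ₗ[ℂ] B) (hf : ∀ x, f (MvPolynomial.X x) = 0) :
    join G f g 1 = 0 := by
  simp [join_apply, edgeT, hf]

theorem join_X (f g : S L →ₗ[ℂ] B) (hf : ∀ x, f (MvPolynomial.X x) = 0)
    (hg : ∀ x, g (MvPolynomial.X x) = 0) (z : L) : join G f g (MvPolynomial.X z) = 0 := by
  simp [join_apply, edgeT, cop, mul_add, Finset.sum_mul, smul_mul_assoc, hf, hg]

/-- Without one-point functions, the tree sums with less than two external edges vanish. -/
theorem treeSum_one_and_X {τ : S L →ₗ[ℂ] B} (h1 : τ 1 = 0)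
    (hX : ∀ x, τ (MvPolynomial.X x) = 0) (v : ℕ) :
    treeSum G τ v 1 = 0 ∧ ∀ x, treeSum G τ v (MvPolynomial.X x) = 0 := by
  induction v using Nat.strong_induction_on with
  | _ v ih =>
    rcases v with _ | v
    · rw [treeSum_zero]
      exact ⟨h1, hX⟩
    · have hv : ((v : ℂ) + 1) ≠ 0 := by exact_mod_cast Nat.succ_ne_zero v
      have key : ∀ a, (∀ i j, i + j = v → join G (treeSum G τ i) (treeSum G τ j) a = 0) →
          treeSum G τ (v + 1) a = 0 := by
        intro a h
        have := LinearMap.congr_fun (treeSum_succ G τ v) a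
        rw [LinearMap.smul_apply, LinearMap.smul_apply, LinearMap.sum_apply,
          Finset.sum_eq_zero, smul_zero] at this
        · exact (smul_eq_zero_iff_right hv).1 this
        · intro t ht
          exact h _ _ (Finset.HasAntidiagonal.mem_antidiagonal.1 ht)
      refine ⟨key _ fun i j hij => join_one G _ _ (ih i (by omega)).2, fun x => key _
        fun i j hij => join_X G _ _ (ih i (by omega)).2 (ih j (by omega)).2 x⟩

omit [DecidableEq L] in
theorem propagator_C (c : ℂ) : propagator G (MvPolynomial.C c) = 0 := by
  simp [propagator, sigmaZero]

theorem connected_C (ν : S L →ₗ[ℂ] ℂ) (c : ℂ) : connected G ν (MvPolynomial.C c) = 0 := by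
  rw [connected, LinearMap.add_apply, propagator_C, zero_add]
  exact MvPowerSeries.ext fun d => graphSum_C G ν IsConn (d 1) (d 0 + d 1 - 1) c

/-- The tree expansion of the connected functions, on elements without constant term. -/
theorem connected_eq_tsum (ν : S L →ₗ[ℂ] ℂ) {a : S L}
    (ha : MvPolynomial.constantCoeff a = 0) :
    Summable (fun v : ℕ => sigmaTerm G (onePI G ν) v a) ∧
      connected G ν a = propagator G a + ∑' v : ℕ, sigmaTerm G (onePI G ν) v a := by
  have h := hasSum_sigmaTerm G ν ha
  exact ⟨h.summable, by rw [h.tsum_eq]; rfl⟩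

theorem sigmaTerm_C (ν : S L →ₗ[ℂ] ℂ) (hX : ∀ x, onePI G ν (MvPolynomial.X x) = 0) (v : ℕ)
    (c : ℂ) : sigmaTerm G (onePI G ν) v (MvPolynomial.C c) = 0 := by
  have h1 : onePI G ν 1 = 0 := by simpa using onePI_C G ν 1
  have h := (treeSum_one_and_X G h1 hX v).1
  rw [← mul_one (MvPolynomial.C c), ← MvPolynomial.smul_eq_C_mul, map_smul]
  exact (congrArg (c • ·) h).trans (smul_zero c)

/-- The tree expansion of the connected functions, in the absence of one-point functions. -/
theorem connected_eq_tsum_of_onePI_X (ν : S L →ₗ[ℂ] ℂ)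
    (hX : ∀ x, onePI G ν (MvPolynomial.X x) = 0) (a : S L) :
    Summable (fun v : ℕ => sigmaTerm G (onePI G ν) v a) ∧
      connected G ν a = propagator G a + ∑' v : ℕ, sigmaTerm G (onePI G ν) v a := by
  have ha : a = (a - MvPolynomial.C (MvPolynomial.constantCoeff a)) +
      MvPolynomial.C (MvPolynomial.constantCoeff a) := (sub_add_cancel _ _).symm
  have h := connected_eq_tsum G ν
    (a := a - MvPolynomial.C (MvPolynomial.constantCoeff a)) (by simp)
  rw [ha]
  simpa only [map_add, connected_C, propagator_C, sigmaTerm_C G ν hX, add_zero] using h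

end Expansion

/-! ### Tree sums as sums over simple trees -/

section Trees

variable {L : Type*} [Fintype L] [DecidableEq L] {B : Type*} [CommRing B] [Algebra ℂ B]
  (G : Matrix L L ℂ) (f : S L →ₗ[ℂ] B)

theorem graphVal_fin_one_zero (s : Fin 0 → Fin 1 × Fin 1) : graphVal G f s = f := by
  refine LinearMap.ext fun a => ?_
  have h : (legsV L (Fin 1)) a = put 0 a := by
    have : legsV L (Fin 1) = put 0 := by
      ext x
      simp [legsV]
    rw [this]
  have h' : evalV f (put (0 : Fin 1) a) = f a := by
    simpa using evalV_prod_put (V := Fin 1) f (fun _ => a)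
  rw [graphVal_apply, h]
  simpa using h'

/-- Connected graphs all of whose edges are bridges are trees. -/
theorem connGraphs_self (e : ℕ) :
    ∀ v, connGraphs G f v e e = if v = e + 1 then treeSum G f e else 0 := by
  induction e using Nat.strong_induction_on with
  | _ e ih =>
    intro v
    rcases e with _ | e
    · rcases Nat.lt_trichotomy v 1 with hv | rfl | hv
      · rw [if_neg hv.ne, Nat.lt_one_iff.1 hv, connGraphs_zero_vertices]
      · rw [if_pos rfl, treeSum_zero, connGraphs, connSum, Fintype.sum_unique, if_pos,
          graphVal_fin_one_zero]
        · simp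
        · refine ⟨⟨⟨0⟩, fun i j => ?_⟩, ?_⟩
          · rw [Subsingleton.elim i j]
            exact Joined.refl _ _ _
          · rw [Set.eq_empty_of_isEmpty (bridges _), Set.ncard_empty]
      · rw [if_neg hv.ne', connGraphs_eq_zero_of_lt_card G f hv]
    · have hb : ((e : ℂ) + 1) ≠ 0 := by exact_mod_cast Nat.succ_ne_zero e
      refine smul_right_injective _ hb ?_
      simp only [connGraphs_succ, smul_ite, treeSum_succ, smul_zero]
      have hw : ∀ t : ℕ × ℕ, ∀ u ∈ Finset.HasAntidiagonal.antidiagonal e,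
          ∑ w ∈ Finset.HasAntidiagonal.antidiagonal e,
            join G (connGraphs G f t.1 u.1 w.1) (connGraphs G f t.2 u.2 w.2) =
          if t = (u.1 + 1, u.2 + 1) then join G (treeSum G f u.1) (treeSum G f u.2) else 0 := by
        intro t u hu
        rw [Finset.sum_eq_single_of_mem u hu]
        · rw [Finset.HasAntidiagonal.mem_antidiagonal] at hu
          rw [ih u.1 (by omega), ih u.2 (by omega)]
          by_cases h₁ : t.1 = u.1 + 1
          · by_cases h₂ : t.2 = u.2 + 1
            · rw [if_pos h₁, if_pos h₂, if_pos (Prod.ext h₁ h₂)]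
            · rw [if_neg h₂, ← joinBilin_apply, map_zero, if_neg]
              rintro rfl
              exact h₂ rfl
          · rw [if_neg h₁, ← joinBilin_apply, map_zero, LinearMap.zero_apply, if_neg]
            rintro rfl
            exact h₁ rfl
        · intro w hw hne
          rw [Finset.HasAntidiagonal.mem_antidiagonal] at hu hw
          rcases Nat.lt_trichotomy u.1 w.1 with h | h | h
          · rw [connGraphs_eq_zero_of_lt G f h, ← joinBilin_apply, map_zero,
              LinearMap.zero_apply]
          · exact absurd (Prod.ext h.symm (by omega)) hne
          · rw [connGraphs_eq_zero_of_lt (e := u.2) G f (by omega), ← joinBilin_apply, map_zero]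
      rw [Finset.sum_congr rfl fun t _ => Finset.sum_congr rfl (hw t), Finset.sum_comm]
      simp only [Finset.sum_ite_eq', Finset.HasAntidiagonal.mem_antidiagonal]
      split_ifs with hv
      · congr 1
        refine Finset.sum_congr rfl fun u hu => if_pos ?_
        rw [Finset.HasAntidiagonal.mem_antidiagonal] at hu
        omega
      · rw [Finset.sum_eq_zero, smul_zero]
        intro u hu
        rw [Finset.HasAntidiagonal.mem_antidiagonal] at hu
        exact if_neg (by omega)

end Trees

section SimpleTrees

open scoped Classical in
/-- On a linearly ordered vertex set, the edges of a simple graph are its increasing pairs of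
adjacent vertices. -/
theorem prod_edgeFinset {M : Type*} [CommMonoid M] {w : ℕ} (T : SimpleGraph (Fin w))
    (g : Sym2 (Fin w) → M) :
    ∏ p ∈ Finset.univ.filter (fun p : Fin w × Fin w => p.1 < p.2 ∧ T.Adj p.1 p.2), g s(p.1, p.2) =
      ∏ z ∈ T.edgeFinset, g z := by
  refine Finset.prod_bij (fun p _ => s(p.1, p.2)) ?_ ?_ ?_ (fun _ _ => rfl)
  · intro p hp
    simpa using (Finset.mem_filter.1 hp).2.2
  · rintro ⟨i, j⟩ hp ⟨i', j'⟩ hp' h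
    simp only [Finset.mem_filter, Finset.mem_univ, true_and] at hp hp'
    rcases Sym2.eq_iff.1 h with ⟨rfl, rfl⟩ | ⟨rfl, rfl⟩
    · rfl
    · exact absurd hp.1 hp'.1.not_gt
  · intro z
    induction z using Sym2.ind with
    | _ i j =>
      intro hz
      have hadj : T.Adj i j := by simpa using hz
      rcases lt_or_gt_of_ne hadj.ne with h | h
      · exact ⟨(i, j), by simp [h, hadj], rfl⟩
      · exact ⟨(j, i), by simp [h, hadj.symm], Sym2.eq_swap⟩

/-- A simple graph that is the skeleton of a connected multigraph with one edge less than it has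
vertices is a tree. -/
theorem isTree_skeleton {e : ℕ} {s : Fin e → Fin (e + 1) × Fin (e + 1)}
    (hs : Conn s Set.univ) : (skeleton s fun _ => True).IsTree := by
  have hc : (skeleton s fun _ => True).Connected := (isConn_iff s).2 hs
  rw [SimpleGraph.isTree_iff_connected_and_card]
  refine ⟨hc, le_antisymm ?_ hc.card_vert_le_card_edgeSet_add_one⟩
  have h1 := Set.ncard_le_ncard (edgeSet_skeleton_subset s fun _ => True) (Set.toFinite _)
  have h2 := Set.ncard_image_le (f := fun k => s((s k).1, (s k).2))
    (Set.toFinite {k : Fin e | True})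
  have h3 := Set.ncard_le_card {k : Fin e | True}
  rw [Nat.card_fin] at h3 ⊢
  rw [Nat.card_coe_set_eq]
  omega

/-- A multigraph with one edge less than it has vertices is disconnected, or becomes so, when any
edge is removed: too few edges remain. -/
theorem ncard_bridges_of_card {e : ℕ} {s : Fin e → Fin (e + 1) × Fin (e + 1)} :
    (bridges s).ncard = e := by
  have : bridges s = Set.univ := by
    refine Set.eq_univ_of_forall fun k h => ?_
    have h1 := h.card_le
    rw [Set.ncard_compl, Set.ncard_singleton, Nat.card_fin] at h1
    have := k.pos
    omega
  rw [this, Set.ncard_univ, Nat.card_fin]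

end SimpleTrees

section TreeSums

variable {L : Type*} [Fintype L] [DecidableEq L] {B : Type*} [CommRing B] [Algebra ℂ B]
  {G : Matrix L L ℂ} {V W : Type} [DecidableEq V] [DecidableEq W]

omit [DecidableEq W] in
theorem edge_comm (hG : G.IsSymm) (i j : V) : edge G i j = edge G j i := by
  have h : ∀ x y, G⁻¹ x y = G⁻¹ y x := fun x y => by
    have : (G⁻¹).transpose = G⁻¹ := by rw [Matrix.transpose_nonsing_inv, hG.eq]
    conv_lhs => rw [← this]
    rfl
  rw [edge, edge, Finset.sum_comm]
  refine Finset.sum_congr rfl fun y _ => Finset.sum_congr rfl fun x _ => ?_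
  rw [h, mul_comm]

/-- The internal edge as a function of the unordered pair of its end points. -/
def symEdge (hG : G.IsSymm) : Sym2 V → VPow L V := Sym2.lift ⟨edge G, edge_comm hG⟩

omit [DecidableEq W] in
@[simp]
theorem symEdge_mk (hG : G.IsSymm) (i j : V) : symEdge hG s(i, j) = edge G i j := rfl

theorem place_symEdge [Fintype V] (hG : G.IsSymm) (g : V → W) (z : Sym2 V) :
    place g (symEdge hG z) = symEdge hG (z.map g) := by
  induction z using Sym2.ind with
  | _ i j => exact place_edge G g i j

open scoped Classical in
/-- The product of the internal edges of a simple graph. -/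
def edgeProd [Fintype V] (hG : G.IsSymm) (T : SimpleGraph V) : VPow L V :=
  ∏ z ∈ T.edgeFinset, symEdge hG z

open scoped Classical in
/-- The numberings and orientations of the edges of a tree all have the same value, and there are
`e! 2^e` of them. -/
theorem sum_skeleton_eq (hG : G.IsSymm) (f : S L →ₗ[ℂ] B) {e : ℕ}
    {T : SimpleGraph (Fin (e + 1))} (hT : T.IsTree) (a : S L) :
    (∑ s : Fin e → Fin (e + 1) × Fin (e + 1),
      if skeleton s (fun _ => True) = T then graphVal G f s a else 0) =
    ((e.factorial : ℂ) * 2 ^ e) • evalV f (edgeProd hG T * legsV L (Fin (e + 1)) a) := by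
  let P := {p : Fin (e + 1) × Fin (e + 1) // p.1 < p.2 ∧ T.Adj p.1 p.2}
  have hP : Fintype.card P = e := by
    have h := hT.card_edgeFinset
    rw [Fintype.card_fin, Finset.card_eq_sum_ones] at h
    have h' : (∑ p ∈ Finset.univ.filter (fun p : Fin (e + 1) × Fin (e + 1) =>
      p.1 < p.2 ∧ T.Adj p.1 p.2), 1) = ∑ z ∈ T.edgeFinset, 1 :=
      prod_edgeFinset (M := Multiplicative ℕ) T fun _ => Multiplicative.ofAdd 1
    rw [← h', ← Finset.card_eq_sum_ones] at h
    rw [Fintype.card_subtype]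
    omega
  have hcard : Fintype.card ((Fin e ≃ P) × (Fin e → Bool)) = e.factorial * 2 ^ e := by
    rw [Fintype.card_prod, Fintype.card_equiv (Fintype.equivFinOfCardEq hP).symm,
      Fintype.card_fin, Fintype.card_fun, Fintype.card_bool, Fintype.card_fin]
  have hsum := Finset.sum_of_injOn (s := Finset.univ) (t := Finset.univ)
    (f := fun _ : (Fin e ≃ P) × (Fin e → Bool) =>
      evalV f (edgeProd hG T * legsV L (Fin (e + 1)) a))
    (g := fun s : Fin e → Fin (e + 1) × Fin (e + 1) =>
      if skeleton s (fun _ => True) = T then graphVal G f s a else 0)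
    (fun t k => if t.2 k then (t.1 k).1 else (t.1 k).1.swap) ?_ (by simp) ?_ ?_
  · rw [← hsum, Finset.sum_const, Finset.card_univ, hcard, ← Nat.cast_smul_eq_nsmul ℂ]
    push_cast
    rfl
  · rintro ⟨σ, o⟩ - ⟨σ', o'⟩ - h
    have key : ∀ k, o k = o' k ∧ σ k = σ' k := by
      intro k
      have hk := congrFun h k
      have h1 := (σ k).2.1
      have h2 := (σ' k).2.1
      dsimp only at hk
      cases ho : o k <;> cases ho' : o' k <;> simp only [ho, ho', if_true, Bool.false_eq_true,
        if_false] at hk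
      · exact ⟨rfl, Subtype.ext (Prod.swap_injective hk)⟩
      · rw [← hk] at h2
        exact absurd h1 h2.not_gt
      · rw [hk] at h1
        exact absurd h1 h2.not_gt
      · exact ⟨rfl, Subtype.ext hk⟩
    exact Prod.ext (Equiv.ext fun k => (key k).2) (funext fun k => (key k).1)
  · intro s _ hs
    refine if_neg fun hsk => hs ?_
    -- Every edge of the tree has a number; since there are as many numbers as edges, the edge
    -- numbers are given by a bijection.
    have hex : ∀ p : P, ∃ k, s k = p.1 ∨ s k = p.1.swap := by
      rintro ⟨⟨i, j⟩, -, h⟩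
      rw [← hsk] at h
      rcases h with ⟨-, ⟨k, -, h⟩ | ⟨k, -, h⟩⟩
      · exact ⟨k, Or.inl h⟩
      · exact ⟨k, Or.inr h⟩
    choose κ hκ using hex
    have hinj : Function.Injective κ := by
      intro p q h
      have h1 := p.2.1
      have h2 := q.2.1
      have hp := hκ p
      have hq := hκ q
      rw [h] at hp
      rcases hp with hp | hp <;> rcases hq with hq | hq <;> rw [hp] at hq
      · exact Subtype.ext hq
      · rw [hq] at h1
        exact absurd h1 h2.not_gt
      · rw [← hq] at h2
        exact absurd h1 h2.not_gt
      · exact Subtype.ext (Prod.swap_injective hq)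
    have hbij : Function.Bijective κ :=
      (Fintype.bijective_iff_injective_and_card κ).2 ⟨hinj, by rw [hP, Fintype.card_fin]⟩
    refine ⟨((Equiv.ofBijective κ hbij).symm, fun k =>
      decide (s k = ((Equiv.ofBijective κ hbij).symm k).1)), by simp, ?_⟩
    funext k
    obtain ⟨p, rfl⟩ := hbij.2 k
    have hp : (Equiv.ofBijective κ hbij).symm (κ p) = p :=
      (Equiv.ofBijective κ hbij).symm_apply_apply p
    simp only [hp, decide_eq_true_eq]
    split_ifs with h
    · exact h.symm
    · exact ((hκ p).resolve_left h).symm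
  · rintro ⟨σ, o⟩ -
    dsimp only
    rw [if_pos, graphVal_apply]
    · congr 2
      rw [edgeProd, ← prod_edgeFinset, Finset.prod_subtype (p := fun p => p.1 < p.2 ∧ T.Adj p.1 p.2)
        _ (by simp), ← σ.prod_comp]
      refine Finset.prod_congr rfl fun k _ => ?_
      split_ifs
      · rfl
      · exact edge_comm hG _ _
    · ext i j
      constructor
      · rintro ⟨-, ⟨k, -, h⟩ | ⟨k, -, h⟩⟩ <;> dsimp only at h <;> split_ifs at h
        · have := (σ k).2.2
          rwa [h] at this
        · have := (σ k).2.2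
          rw [← Prod.swap_swap (σ k).1, h] at this
          exact this.symm
        · have := (σ k).2.2
          rw [h] at this
          exact this.symm
        · have := (σ k).2.2
          rwa [← Prod.swap_swap (σ k).1, h] at this
      · intro h
        refine ⟨h.ne, ?_⟩
        have key : ∀ p : P, ∃ k, (if o k then (σ k).1 else (σ k).1.swap) = p.1 ∨
            (if o k then (σ k).1 else (σ k).1.swap) = p.1.swap := by
          intro p
          refine ⟨σ.symm p, ?_⟩
          split_ifs
          · exact Or.inl (by rw [σ.apply_symm_apply])
          · exact Or.inr (by rw [σ.apply_symm_apply])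
        rcases lt_or_gt_of_ne h.ne with hlt | hlt
        · obtain ⟨k, hk | hk⟩ := key ⟨(i, j), hlt, h⟩
          · exact Or.inl ⟨k, trivial, hk⟩
          · exact Or.inr ⟨k, trivial, hk⟩
        · obtain ⟨k, hk | hk⟩ := key ⟨(j, i), hlt, h.symm⟩
          · exact Or.inr ⟨k, trivial, hk⟩
          · exact Or.inl ⟨k, trivial, hk⟩

open scoped Classical in
/-- The tree sum as a sum over trees with numbered vertices. -/
theorem treeSum_eq_sum_isTree (hG : G.IsSymm) (f : S L →ₗ[ℂ] B) (e : ℕ) (a : S L) :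
    treeSum G f e a = (1 / ((e + 1).factorial : ℂ)) •
      ∑ T : SimpleGraph (Fin (e + 1)),
        if T.IsTree then evalV f (edgeProd hG T * legsV L (Fin (e + 1)) a) else 0 := by
  have h := LinearMap.congr_fun (connGraphs_self G f e (e + 1)) a
  rw [if_pos rfl] at h
  have hs : ∀ s : Fin e → Fin (e + 1) × Fin (e + 1),
      (if Conn s Set.univ ∧ (bridges s).ncard = e then graphVal G f s else 0) a =
      ∑ T : SimpleGraph (Fin (e + 1)), if T.IsTree then
        if skeleton s (fun _ => True) = T then graphVal G f s a else 0 else 0 := by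
    intro s
    rw [Finset.sum_eq_single_of_mem (skeleton s fun _ => True) (Finset.mem_univ _), if_pos rfl]
    · by_cases hc : Conn s Set.univ
      · rw [if_pos ⟨hc, ncard_bridges_of_card⟩, if_pos (isTree_skeleton hc)]
      · rw [if_neg fun h => hc h.1, if_neg fun h => hc ((isConn_iff s).1 h.connected),
          LinearMap.zero_apply]
    · intro T _ hT
      rw [if_neg (Ne.symm hT), ite_self]
  rw [← h, connGraphs, LinearMap.smul_apply, connSum, LinearMap.sum_apply,
    Finset.sum_congr rfl fun s _ => hs s, Finset.sum_comm, Finset.smul_sum, Finset.smul_sum]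
  refine Finset.sum_congr rfl fun T _ => ?_
  split_ifs with hT
  · rw [sum_skeleton_eq hG f hT a, smul_smul]
    congr 1
    have h1 : (e.factorial : ℂ) ≠ 0 := by exact_mod_cast e.factorial_ne_zero
    have h2 : ((e + 1).factorial : ℂ) ≠ 0 := by exact_mod_cast (e + 1).factorial_ne_zero
    field_simp
  · simp

end TreeSums

/-! ### Trees without automorphisms -/

section Rigidity

variable {V : Type}

/-- In a rooted tree, every vertex has at most one neighbour that is closer to the root. -/
theorem eq_of_adj_of_dist_lt {T : SimpleGraph V} (hT : T.IsTree) {r y a b : V} (ha : T.Adj y a)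
    (hb : T.Adj y b) (hda : T.dist r a < T.dist r y) (hdb : T.dist r b < T.dist r y) :
    a = b := by
  classical
  obtain ⟨p, hp, -⟩ := (hT.connected r y).exists_path_of_dist
  have key : ∀ c, T.Adj y c → T.dist r c < T.dist r y → c = p.penultimate := by
    intro c hc hd
    obtain ⟨q, hq, hq'⟩ := (hT.connected r c).exists_path_of_dist
    have hy : y ∉ q.support := by
      intro hy
      have h1 := SimpleGraph.dist_le (q.takeUntil y hy)
      have h2 := q.length_takeUntil_le_length hy
      omega
    exact hT.isAcyclic.eq_penultimate_of_adj_end hp hc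
      (hT.isAcyclic.mem_support_of_ne_mem_support_of_adj_of_isPath hp hq hc hy)
  rw [key a ha hda, key b hb hdb]

/-- An automorphism of a finite tree that fixes all vertices with at most one neighbour is the
identity. -/
theorem tree_perm_eq_one [Finite V] {T : SimpleGraph V} (hT : T.IsTree) (π : Equiv.Perm V)
    (hπ : ∀ i j, T.Adj (π i) (π j) ↔ T.Adj i j)
    (hfix : ∀ i, (T.neighborSet i).Subsingleton → π i = i) : π = 1 := by
  by_contra hne
  obtain ⟨x₀, hx₀⟩ : ∃ x, π x ≠ x := by
    by_contra! h
    exact hne (Equiv.ext h)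
  -- Among the vertices that are moved, take one at maximal distance from some root.
  obtain ⟨x, hx, hmax⟩ := Set.exists_max_image {x | π x ≠ x} (T.dist x₀) (Set.toFinite _)
    ⟨x₀, hx₀⟩
  have hx : π x ≠ x := hx
  obtain ⟨y, hy, hdy⟩ : ∃ y, T.Adj x y ∧ T.dist x₀ x < T.dist x₀ y := by
    by_contra! h
    refine hx (hfix x fun a ha b hb => ?_)
    have hlt : ∀ c, T.Adj x c → T.dist x₀ c < T.dist x₀ x := fun c hc =>
      lt_of_le_of_ne (h c hc) (hT.dist_ne_of_adj x₀ hc.symm)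
    exact eq_of_adj_of_dist_lt hT ha hb (hlt a ha) (hlt b hb)
  have hyfix : π y = y := by
    by_contra h
    exact absurd (hmax y h) hdy.not_ge
  have hadj : T.Adj y (π x) := by
    have := (hπ y x).2 hy.symm
    rwa [hyfix] at this
  have hd : T.dist x₀ (π x) < T.dist x₀ y :=
    (hmax (π x) fun h => hx (π.injective h)).trans_lt hdy
  exact hx (eq_of_adj_of_dist_lt hT hadj hy.symm hd hdy)

end Rigidity

section Valence

variable {L : Type*} [Fintype L] [DecidableEq L] {B : Type*} [CommRing B] [Algebra ℂ B]
  {G : Matrix L L ℂ} {V : Type} [Fintype V] [DecidableEq V]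

/-- The tensors that are `1` in the factor `i`, i.e. the image of the tensor power over the other
vertices. -/
def awayFrom (L : Type*) (i : V) : Subalgebra ℂ (VPow L V) :=
  (place (L := L) (Subtype.val : {j // j ≠ i} → V)).range

omit [Fintype L] [DecidableEq L] in
theorem put_mem_awayFrom {i j : V} (h : j ≠ i) (a : S L) : put j a ∈ awayFrom L i :=
  ⟨put ⟨j, h⟩ a, place_put _ _ _⟩

omit [Fintype L] [DecidableEq L] in
/-- A factor `m` with `f m = 0` at one vertex makes the whole tensor vanish. -/
theorem evalV_put_mul {f : S L →ₗ[ℂ] B} {i : V} {m : S L} (hm : f m = 0) {u : VPow L V}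
    (hu : u ∈ awayFrom L i) : evalV f (put i m * u) = 0 := by
  obtain ⟨u, rfl⟩ := hu
  have h := evalV_place_mul_place (V₁ := {j // j = i}) (V₂ := {j // j ≠ i})
    (Equiv.sumCompl (· = i)) f (put ⟨i, rfl⟩ m) u
  have h0 : evalV f (put (⟨i, rfl⟩ : {j // j = i}) m) = 0 := by
    have := evalV_prod_put (V := {j // j = i}) f fun _ => m
    rw [Fintype.prod_unique, Fintype.prod_unique] at this
    exact this.trans hm
  rw [h0, zero_mul, place_put] at h
  exact h

theorem edge_mem_awayFrom {i j k : V} (hj : j ≠ i) (hk : k ≠ i) :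
    edge G j k ∈ awayFrom L i :=
  Subalgebra.sum_mem _ fun _ _ => Subalgebra.sum_mem _ fun _ _ => Subalgebra.smul_mem _
    (Subalgebra.mul_mem _ (put_mem_awayFrom hj _) (put_mem_awayFrom hk _)) _

theorem symEdge_mem_awayFrom (hG : G.IsSymm) {i : V} {z : Sym2 V} (h : i ∉ z) :
    symEdge hG z ∈ awayFrom L i := by
  induction z using Sym2.ind with
  | _ j k =>
    rw [Sym2.mem_iff, not_or] at h
    exact edge_mem_awayFrom (Ne.symm h.1) (Ne.symm h.2)

theorem evalV_edge_mul {f : S L →ₗ[ℂ] B} (hX : ∀ x, f (MvPolynomial.X x) = 0) {i j : V}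
    (hj : j ≠ i) {u : VPow L V} (hu : u ∈ awayFrom L i) : evalV f (edge G i j * u) = 0 := by
  simp only [edge, Finset.sum_mul, map_sum]
  refine Finset.sum_eq_zero fun x _ => Finset.sum_eq_zero fun y _ => ?_
  rw [PiTensorProduct.mul_def, map_smul, LinearMap.smul_apply, map_smul,
    ← PiTensorProduct.mul_def, mul_assoc, evalV_put_mul (hX x) (Subalgebra.mul_mem _ (put_mem_awayFrom hj _) hu), smul_zero]

open scoped Classical in
/-- Without one-point functions, tree graphs with a vertex of valence at most one vanish. -/
theorem evalV_eq_zero_of_valence_lt (hG : G.IsSymm) {f : S L →ₗ[ℂ] B} (h1 : f 1 = 0)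
    (hX : ∀ x, f (MvPolynomial.X x) = 0) (T : SimpleGraph V) {n : ℕ} (x : Fin n → L)
    (leg : Fin n → V) {i : V} (hi : (T.neighborSet i).ncard + {k | leg k = i}.ncard < 2) :
    evalV f (edgeProd hG T * ∏ k, put (leg k) (MvPolynomial.X (x k))) = 0 := by
  have hlegs : ∀ s : Finset (Fin n), (∀ k ∈ s, leg k ≠ i) →
      ∏ k ∈ s, put (leg k) (MvPolynomial.X (x k)) ∈ awayFrom L i := fun s h =>
    Subalgebra.prod_mem _ fun k hk => put_mem_awayFrom (h k hk) _
  have hedges : ∀ s : Finset (Sym2 V), (∀ z ∈ s, i ∉ z) →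
      ∏ z ∈ s, symEdge hG z ∈ awayFrom L i := fun s h =>
    Subalgebra.prod_mem _ fun z hz => symEdge_mem_awayFrom hG (h z hz)
  by_cases hedge : ∃ z ∈ T.edgeFinset, i ∈ z
  · obtain ⟨z, hz, hiz⟩ := hedge
    obtain ⟨j, rfl⟩ := Sym2.mem_iff_exists.1 hiz
    have hij : T.Adj i j := by simpa using hz
    have hn : 0 < (T.neighborSet i).ncard := (Set.ncard_pos (Set.toFinite _)).2 ⟨j, hij⟩
    have hl : ∀ k, leg k ≠ i := by
      intro k hk
      have : 0 < {k | leg k = i}.ncard := (Set.ncard_pos (Set.toFinite _)).2 ⟨k, hk⟩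
      omega
    have ho : ∀ z ∈ T.edgeFinset.erase s(i, j), i ∉ z := by
      intro z hz hiz'
      obtain ⟨k, rfl⟩ := Sym2.mem_iff_exists.1 hiz'
      rw [Finset.mem_erase] at hz
      have hik : T.Adj i k := by simpa using hz.2
      have hjk : j ≠ k := by
        rintro rfl
        exact hz.1 rfl
      have : 1 < (T.neighborSet i).ncard :=
        (Set.one_lt_ncard (Set.toFinite _)).2 ⟨j, hij, k, hik, hjk⟩
      omega
    rw [edgeProd, ← Finset.mul_prod_erase _ _ hz, symEdge_mk, mul_assoc]
    exact evalV_edge_mul hX hij.ne' (Subalgebra.mul_mem _ (hedges _ ho) (hlegs _ fun k _ => hl k))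
  · push Not at hedge
    have he := hedges _ hedge
    by_cases hleg : ∃ k, leg k = i
    · obtain ⟨k, hk⟩ := hleg
      have ho : ∀ l ∈ Finset.univ.erase k, leg l ≠ i := by
        intro l hl hli
        have : 1 < {k | leg k = i}.ncard :=
          (Set.one_lt_ncard (Set.toFinite _)).2 ⟨k, hk, l, hli, (Finset.ne_of_mem_erase hl).symm⟩
        omega
      rw [← Finset.mul_prod_erase _ _ (Finset.mem_univ k), mul_left_comm, hk]
      exact evalV_put_mul (hX _) (Subalgebra.mul_mem _ he (hlegs _ ho))
    · push Not at hleg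
      rw [← one_mul (edgeProd hG T * _), ← map_one (put i)]
      exact evalV_put_mul h1 (Subalgebra.mul_mem _ he (hlegs _ fun k _ => hleg k))

end Valence

section Orbits

variable {v n : ℕ}

theorem TreeGraph.ext_graph_leg {s t : TreeGraph v n} (h : s.graph = t.graph)
    (h' : s.leg = t.leg) : s = t := by
  cases s; cases t; simp_all

instance : Finite (TreeGraph v n) :=
  Finite.of_injective (fun t : TreeGraph v n => (t.graph, t.leg)) fun _ _ h =>
    TreeGraph.ext_graph_leg (congrArg Prod.fst h) (congrArg Prod.snd h)

instance : Fintype (TreeGraph v n) := Fintype.ofFinite _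

instance : Finite (UnorderedTree v n) := Quotient.finite _

/-- Renumbering the vertices of a tree graph. -/
def TreeGraph.renumber (t : TreeGraph v n) (π : Equiv.Perm (Fin v)) : TreeGraph v n where
  graph := t.graph.comap π.symm
  leg := π ∘ t.leg
  isTree := (SimpleGraph.Iso.comap π.symm t.graph).isTree_iff.2 t.isTree
  two_le_valence i := by
    have h1 : (t.graph.comap π.symm).neighborSet i =
        π '' t.graph.neighborSet (π.symm i) := by
      ext j
      rw [π.image_eq_preimage_symm]
      rfl
    have h2 : {k | (π ∘ t.leg) k = i} = {k | t.leg k = π.symm i} := by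
      ext k
      simp [Equiv.eq_symm_apply]
    rw [h1, h2, Set.ncard_image_of_injective _ π.injective]
    exact t.two_le_valence _

/-- Tree graphs in which all vertices have valence at least two have no automorphisms: a vertex
with at most one neighbour has an external edge, so it is fixed. -/
theorem TreeGraph.renumber_injective (t : TreeGraph v n) :
    Function.Injective t.renumber := by
  intro π ρ h
  have hadj : ∀ i j, t.graph.Adj (π.symm i) (π.symm j) ↔ t.graph.Adj (ρ.symm i) (ρ.symm j) :=
    fun i j => by
      have := congrArg (fun t => t.graph.Adj i j) h
      exact iff_of_eq this
  have hleg : ∀ k, π (t.leg k) = ρ (t.leg k) := fun k => congrArg (fun t => t.leg k) h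
  have h1 : ρ.symm * π = 1 := by
    refine tree_perm_eq_one t.isTree _ (fun i j => ?_) fun i hi => ?_
    · have := hadj (π i) (π j)
      simpa using this.symm
    · have h2 := t.two_le_valence i
      have h3 := (Set.ncard_le_one_iff_subsingleton (s := t.graph.neighborSet i)).2 hi
      obtain ⟨k, hk⟩ := (Set.ncard_pos (Set.toFinite {k | t.leg k = i})).1 (by omega)
      have hk : t.leg k = i := hk
      have := hleg k
      rw [hk] at this
      simp [this]
  ext i
  have := congrArg (fun σ => ρ (σ i)) h1
  simpa using congrArg Fin.val this

theorem treeSetoid_iff (s t : TreeGraph v n) :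
    (treeSetoid v n).r s t ↔ ∃ π, s.renumber π = t := by
  constructor
  · rintro ⟨π, h, h'⟩
    refine ⟨π, TreeGraph.ext_graph_leg ?_ (funext fun k => (h' k).symm)⟩
    ext i j
    rw [← π.apply_symm_apply i, ← π.apply_symm_apply j, h]
    simp [TreeGraph.renumber]
  · rintro ⟨π, rfl⟩
    exact ⟨π, fun i j => by simp [TreeGraph.renumber], fun k => rfl⟩

/-- Every tree graph can be numbered in `v!` ways. -/
theorem sum_treeGraph {M : Type*} [AddCommMonoid M] (h : TreeGraph v n → M)
    (hinv : ∀ t π, h (t.renumber π) = h t) :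
    ∑ t, h t = v.factorial • ∑ᶠ q : UnorderedTree v n, h (Quotient.out q) := by
  classical
  let : Fintype (UnorderedTree v n) := Fintype.ofFinite _
  let cls : TreeGraph v n → UnorderedTree v n := Quotient.mk (treeSetoid v n)
  rw [finsum_eq_sum_of_fintype, Finset.smul_sum, ← Finset.sum_fiberwise Finset.univ cls]
  refine Finset.sum_congr rfl fun q _ => ?_
  have hcard : v.factorial = (Finset.univ : Finset (Equiv.Perm (Fin v))).card := by
    rw [Finset.card_univ, Fintype.card_perm, Fintype.card_fin]
  rw [hcard, ← Finset.sum_const]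
  symm
  refine Finset.sum_of_injOn (fun π => (Quotient.out q).renumber π)
    (TreeGraph.renumber_injective _).injOn ?_ ?_ ?_
  · intro π _
    rw [Finset.mem_coe, Finset.mem_filter]
    refine ⟨Finset.mem_univ _, ?_⟩
    conv_rhs => rw [← Quotient.out_eq q]
    exact (Quotient.sound ((treeSetoid_iff _ _).2 ⟨π, rfl⟩)).symm
  · intro t ht ht'
    refine absurd ?_ ht'
    rw [Finset.mem_filter] at ht
    have : (treeSetoid v n).r (Quotient.out q) t := by
      exact Quotient.exact (s := treeSetoid v n) ((Quotient.out_eq q).trans ht.2.symm)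
    obtain ⟨π, hπ⟩ := (treeSetoid_iff _ _).1 this
    exact ⟨π, by simp, hπ⟩
  · intro π _
    exact (hinv _ _).symm

end Orbits

section TreeExpansion

variable {L : Type*} [Fintype L] [DecidableEq L] {G : Matrix L L ℂ} {n : ℕ}

theorem treeValue_eq (hG : G.IsSymm) (τ : S L →ₗ[ℂ] Series) {v : ℕ} (x : Fin n → L)
    (t : TreeGraph v n) : treeValue G τ x t =
      evalV τ (edgeProd hG t.graph * ∏ k, put (t.leg k) (MvPolynomial.X (x k))) := by
  classical
  rw [edgeProd, ← prod_edgeFinset]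
  unfold treeValue
  congr!

theorem treeValue_renumber (hG : G.IsSymm) (τ : S L →ₗ[ℂ] Series) {v : ℕ} (x : Fin n → L)
    (t : TreeGraph v n) (π : Equiv.Perm (Fin v)) :
    treeValue G τ x (t.renumber π) = treeValue G τ x t := by
  classical
  have hedges : edgeProd hG (t.renumber π).graph = place π (edgeProd hG t.graph) := by
    rw [edgeProd, edgeProd, map_prod]
    symm
    refine Finset.prod_bij (fun z _ => z.map π) ?_ ?_ ?_ fun z _ => place_symEdge hG π z
    · intro z
      induction z using Sym2.ind with
      | _ i j =>
        simp only [SimpleGraph.mem_edgeFinset, Sym2.map_mk, SimpleGraph.mem_edgeSet]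
        simp [TreeGraph.renumber]
    · exact fun z _ z' _ h => Sym2.map.injective π.injective h
    · intro z hz
      refine ⟨z.map π.symm, ?_, ?_⟩
      · induction z using Sym2.ind with
        | _ i j =>
          simp only [SimpleGraph.mem_edgeFinset, Sym2.map_mk, SimpleGraph.mem_edgeSet] at hz ⊢
          exact hz
      · simp [Sym2.map_map]
  rw [treeValue_eq hG, treeValue_eq hG, hedges,
    ← evalV_place_equiv π τ (edgeProd hG t.graph * _), map_mul (place (L := L) π), map_prod]
  simp [TreeGraph.renumber]

/-- The tree sum over unnumbered trees. -/
theorem sigmaTerm_eq_finsum (hG : G.IsSymm) {τ : S L →ₗ[ℂ] Series} (h1 : τ 1 = 0)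
    (hX : ∀ x, τ (MvPolynomial.X x) = 0) (v : ℕ) (x : Fin n → L) :
    sigmaTerm G τ v (∏ k, MvPolynomial.X (x k)) =
      ∑ᶠ t : UnorderedTree (v + 1) n, treeValue G τ x (Quotient.out t) := by
  classical
  have hsum : ∑ T : SimpleGraph (Fin (v + 1)), (if T.IsTree then
      evalV τ (edgeProd hG T * legsV L (Fin (v + 1)) (∏ k, MvPolynomial.X (x k))) else 0) =
      ∑ t : TreeGraph (v + 1) n, treeValue G τ x t := by
    have hlegs : legsV L (Fin (v + 1)) (∏ k, MvPolynomial.X (x k)) =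
        ∑ leg : Fin n → Fin (v + 1), ∏ k, put (leg k) (MvPolynomial.X (x k)) :=
      legs_prod (v + 1) n x
    simp only [hlegs, Finset.mul_sum, map_sum]
    have : ∀ T : SimpleGraph (Fin (v + 1)), (if T.IsTree then
        ∑ leg : Fin n → Fin (v + 1),
          evalV τ (edgeProd hG T * ∏ k, put (leg k) (MvPolynomial.X (x k))) else 0) =
        ∑ leg : Fin n → Fin (v + 1), if T.IsTree then
          evalV τ (edgeProd hG T * ∏ k, put (leg k) (MvPolynomial.X (x k))) else 0 := by
      intro T
      split_ifs <;> simp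
    simp only [this]
    rw [← Fintype.sum_prod_type' (f := fun (T : SimpleGraph (Fin (v + 1)))
      (leg : Fin n → Fin (v + 1)) => if T.IsTree then
          evalV τ (edgeProd hG T * ∏ k, put (leg k) (MvPolynomial.X (x k))) else 0)]
    symm
    refine Finset.sum_of_injOn (fun t : TreeGraph (v + 1) n => (t.graph, t.leg)) ?_ (by simp) ?_ ?_
    · intro s _ t _ h
      exact TreeGraph.ext_graph_leg (congrArg Prod.fst h) (congrArg Prod.snd h)
    · rintro ⟨T, leg⟩ _ hT
      dsimp only
      split_ifs with htree
      · by_contra hne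
        refine hT ⟨⟨T, leg, htree, fun i => ?_⟩, by simp, rfl⟩
        by_contra hi
        exact hne (evalV_eq_zero_of_valence_lt hG h1 hX T x leg (not_le.1 hi))
      · rfl
    · intro t _
      rw [if_pos t.isTree, treeValue_eq hG]
  have h := treeSum_eq_sum_isTree hG τ v (∏ k, MvPolynomial.X (x k))
  have hfac : ((v + 1).factorial : ℂ) ≠ 0 := by exact_mod_cast (v + 1).factorial_ne_zero
  rw [hsum, sum_treeGraph _ fun t π => treeValue_renumber hG τ x t π,
    ← Nat.cast_smul_eq_nsmul ℂ, smul_smul, one_div_mul_cancel hfac, one_smul] at h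
  exact h

end TreeExpansion

end FieldAlgebra

end

theorem theorem5 {L : Type*} [Fintype L] [DecidableEq L]
    (G : Matrix L L ℂ) (hsymm : G.IsSymm) (hdet : IsUnit G.det)
    (ν : FieldAlgebra.S L →ₗ[ℂ] ℂ) :
    (∀ a : FieldAlgebra.S L, MvPolynomial.constantCoeff a = 0 →
      Summable (fun v : ℕ => FieldAlgebra.sigmaTerm G (FieldAlgebra.onePI G ν) v a) ∧
      FieldAlgebra.connected G ν a = FieldAlgebra.propagator G a +
        ∑' v : ℕ, FieldAlgebra.sigmaTerm G (FieldAlgebra.onePI G ν) v a) ∧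
    ((∀ x : L, FieldAlgebra.onePI G ν (MvPolynomial.X x) = 0) →
      (∀ a : FieldAlgebra.S L,
        Summable (fun v : ℕ => FieldAlgebra.sigmaTerm G (FieldAlgebra.onePI G ν) v a) ∧
        FieldAlgebra.connected G ν a = FieldAlgebra.propagator G a +
          ∑' v : ℕ, FieldAlgebra.sigmaTerm G (FieldAlgebra.onePI G ν) v a) ∧
      (∀ (v n : ℕ) (x : Fin n → L),
        FieldAlgebra.sigmaTerm G (FieldAlgebra.onePI G ν) v (∏ k, MvPolynomial.X (x k)) =
          ∑ᶠ t : FieldAlgebra.UnorderedTree (v + 1) n,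
            FieldAlgebra.treeValue G (FieldAlgebra.onePI G ν) x (Quotient.out t))) := by
  refine ⟨fun a ha => FieldAlgebra.connected_eq_tsum G ν ha, fun hX =>
    ⟨FieldAlgebra.connected_eq_tsum_of_onePI_X G ν hX, fun v n x => ?_⟩⟩
  exact FieldAlgebra.sigmaTerm_eq_finsum hsymm (by simpa using FieldAlgebra.onePI_C G ν 1) hX v x
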